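/- Let $p_Z$ be a probability density function on $\mathbb{R}$ and let $\Delta>0$. Consider the memoryless additive-noise channel $Y_i=X_i+Z_i$, $i=1,\dots,n$, where $Z_1,\dots,Z_n$ are i.i.d. with density $p_Z$. A code of length $n$ with finite nonempty message set $\mathcal M$ and finite nonempty key set $\mathcal K$ is a pair consisting of an encoder $f\colon\mathcal M\times\mathcal K\to\mathbb R^n$ and a (measurable) decoder $g\colon\mathbb R^n\times\mathcal K\to\mathcal M$; message and key are uniform, independent of each other and of the noise $Z^n$, and $X^n$ is the encoder's output. Let $P_{Y^n}$ be the resulting law of $Y^n=X^n+Z^n$ (averaged over message and key) and $P_{Z^n}$ the law of $Z^n$. For $\epsilon>0$ let $A_n(\Delta,\epsilon)$ be the maximum of $\ln|\mathcal M|$ over all codes of length $n$ (with any finite key set) that satisfy $D(P_{Y^n}\|P_{Z^n})\le\Delta$ and whose probability of decoding error, averaged over message and key, is at most $\epsilon$. Define $$L=\lim_{\epsilon\downarrow0}\ \liminf_{n\to\infty}\frac{A_n(\Delta,\epsilon)}{\sqrt{n\Delta}}.$$ Assume that for some $\zeta\in(0,1)$ $$\int_{\mathbb R} p_Z(\ln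 p_Z)^4\,dz<\infty,\qquad \int_{\mathbb R} p_Z^{\zeta}\,dz<\infty,\qquad \int_{\mathbb R} p_Z^{\zeta}(\ln p_Z)^4\,dz<\infty,$$ and that 1. $p_Z$ is bounded; 2. $z\mapsto p_Z(z)\ln p_Z(z)$ is uniformly continuous on $\operatorname{supp}(p_Z)=\{z: p_Z(z)\neq 0\}$; 3. there is $\xi\in(0,1)$ such that for every $\gamma\in[0,\xi)$ there is a random variable $X$, independent of $Z\sim p_Z$, such that $X+Z$ has the density $\alpha\,p_Z^{1-\gamma}$, where $\alpha=\bigl(\int_{\mathbb R}p_Z(z)^{1-\gamma}\,dz\bigr)^{-1}$. Then the limit $L$ exists and $$L=\sqrt2\,\sqrt{\operatorname{Var}[\ln p_Z(Z)]},\qquad Z\sim p_Z.$$ -/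

import Mathlib

open MeasureTheory ProbabilityTheory Filter Topology

noncomputable section

namespace Covert

/-- `p` is a probability density function on `ℝ` with respect to Lebesgue measure. -/
structure IsPDF (p : ℝ → ℝ) : Prop where
  nonneg : ∀ z, 0 ≤ p z
  integrable : Integrable p volume
  integral_eq_one : ∫ z, p z = 1

/-- The measure on `ℝ` with Lebesgue density `p`. -/
def lawOf (p : ℝ → ℝ) : Measure ℝ :=
  volume.withDensity fun z => ENNReal.ofReal (p z)

/-- The law of the noise vector `Zⁿ` whose coordinates are i.i.d. with density `p`. -/
def noiseLaw (p : ℝ → ℝ) (n : ℕ) : Measure (Fin n → ℝ) :=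
  Measure.pi fun _ => lawOf p

/-- A code of length `n` for the message set `Fin M` and the key set `Fin K`: an encoder, and a
decoder with measurable decision regions. -/
structure Code (n M K : ℕ) where
  encode : Fin M → Fin K → (Fin n → ℝ)
  decode : (Fin n → ℝ) → Fin K → Fin M
  measurableSet_decode : ∀ k m, MeasurableSet {y | decode y k = m}

/-- The law of the channel output `Yⁿ = Xⁿ + Zⁿ` when the message and the key are uniform,
independent of each other and of the noise. -/
def Code.outputLaw {n M K : ℕ} (C : Code n M K) (p : ℝ → ℝ) : Measure (Fin n → ℝ) :=
  ((K : ENNReal) * (M : ENNReal))⁻¹ •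
    ∑ m : Fin M, ∑ k : Fin K, (noiseLaw p n).map fun z => C.encode m k + z

/-- The probability of decoding error, averaged over the message and the key. -/
def Code.errorProb {n M K : ℕ} (C : Code n M K) (p : ℝ → ℝ) : ℝ :=
  ((K : ℝ) * (M : ℝ))⁻¹ *
    ∑ m : Fin M, ∑ k : Fin K,
      (noiseLaw p n).real {z | C.decode (C.encode m k + z) k ≠ m}

/-- There is a code of length `n` with `M` messages (and some finite nonempty key set) that
satisfies `D(P_{Yⁿ} ‖ P_{Zⁿ}) ≤ Δ` and has average error probability at most `ε`. -/
def Achievable (p : ℝ → ℝ) (n : ℕ) (Δ ε : ℝ) (M : ℕ) : Prop :=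
  0 < M ∧ ∃ K : ℕ, 0 < K ∧ ∃ C : Code n M K,
    InformationTheory.klDiv (C.outputLaw p) (noiseLaw p n) ≤ ENNReal.ofReal Δ ∧
    C.errorProb p ≤ ε

/-- `A_n(Δ, ε)`: the largest `ln |M|` over all covert and reliable codes of length `n`, as a
supremum in the extended reals. -/
def maxLogSize (p : ℝ → ℝ) (n : ℕ) (Δ ε : ℝ) : EReal :=
  ⨆ (M : ℕ) (_ : Achievable p n Δ ε M), ((Real.log M : ℝ) : EReal)

/-- `L = lim_{ε ↓ 0} liminf_{n → ∞} A_n(Δ, ε) / √(n Δ)`, existence of the limit included. -/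
def IsScalingConstant (p : ℝ → ℝ) (Δ L : ℝ) : Prop :=
  Tendsto
    (fun ε : ℝ => liminf (fun n : ℕ => maxLogSize p n Δ ε / ((√(n * Δ) : ℝ) : EReal)) atTop)
    (𝓝[>] 0) (𝓝 (L : EReal))

/-- The integrability conditions on the noise density. -/
def IntegrabilityConditions (p : ℝ → ℝ) : Prop :=
  ∃ ζ ∈ Set.Ioo (0 : ℝ) 1,
    Integrable (fun z => p z * Real.log (p z) ^ 4) volume ∧
    Integrable (fun z => p z ^ ζ) volume ∧
    Integrable (fun z => p z ^ ζ * Real.log (p z) ^ 4) volume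

/-- The tilted density `α p^{1-γ}`, with `α` the inverse of `∫ p^{1-γ}`. -/
def tilted (p : ℝ → ℝ) (γ : ℝ) (z : ℝ) : ℝ :=
  (∫ t, p t ^ (1 - γ))⁻¹ * p z ^ (1 - γ)

/-- There is a random variable `X`, independent of some `Z` with density `p`, such that `X + Z`
has density `q`. -/
def IsAdditiveOutput (p q : ℝ → ℝ) : Prop :=
  ∃ (Ω : Type) (_ : MeasurableSpace Ω) (P : Measure Ω) (X Z : Ω → ℝ),
    IsProbabilityMeasure P ∧ Measurable X ∧ Measurable Z ∧ IndepFun X Z P ∧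
    P.map Z = lawOf p ∧ P.map (fun ω => X ω + Z ω) = lawOf q

/-- The additional assumptions on the noise density: it is bounded, `p ln p` is uniformly
continuous on the support of `p`, and for all small `γ` the tilted density is the density of
`X + Z` for some `X` independent of `Z`. -/
structure TightnessAssumption (p : ℝ → ℝ) : Prop where
  bounded : ∃ b > 0, ∀ z, p z ≤ b
  uniformContinuousOn :
    UniformContinuousOn (fun z => p z * Real.log (p z)) (Function.support p)
  decomposable : ∃ ξ ∈ Set.Ioo (0 : ℝ) 1, ∀ γ ∈ Set.Ico 0 ξ, IsAdditiveOutput p (tilted p γ)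

end Covert

end

/-
Write `U = -ln p(Z)`, `V = Var[U]`, and let `Λ` be the cumulant generating function of `U`, so that
the tilted density `α p ^ (1 - γ)` is `exp (γ U - Λ γ)` relative to `p`. Take `γ = c / √n`.

Achievability: draw the codewords independently from the input law that makes the channel output
have the density `α p ^ (1 - γ)` in each coordinate. With enough keys, the mean divergence of the
output from the noise is close to `n (γ Λ' γ - Λ γ) ≈ c ^ 2 V / 2`, while by Chebyshev's inequality
typical-set decoding supports every `ln M` slightly below the mutual information
`n (Λ' γ - Λ' 0) ≈ c V √n`. The choice `c ^ 2 V / 2 = Δ` gives `ln M ≈ √(2 V) √(n Δ)`.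

Converse: comparing the output law under a fixed key with the noise law bounds
`(1 - ε) ln M` by the mean increase of the total information content caused by the codeword, and
the Donsker–Varadhan inequality bounds `γ` times this increase by `Δ + n (Λ γ - γ Λ' 0)`. Dividing
by `γ` and optimizing over `c` gives the same constant.
-/

namespace Covert

open scoped ENNReal

section General

variable {X Y ι : Type*} [MeasurableSpace X] [MeasurableSpace Y] [Fintype ι] {E : ι → Type*}
  [∀ i, MeasurableSpace (E i)]

theorem lintegral_pi_ofReal_prod (μ : ∀ i, Measure (E i)) [∀ i, SigmaFinite (μ i)]
    {f : ∀ i, E i → ℝ} (hf : ∀ i, Integrable (f i) (μ i)) (hf0 : ∀ i x, 0 ≤ f i x) :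
    ∫⁻ x, ENNReal.ofReal (∏ i, f i (x i)) ∂(Measure.pi μ)
      = ∏ i, ∫⁻ x, ENNReal.ofReal (f i x) ∂(μ i) := by
  rw [← ofReal_integral_eq_lintegral_ofReal (Integrable.fintype_prod_dep hf)
    (ae_of_all _ fun x => Finset.prod_nonneg fun i _ => hf0 i _), integral_fintype_prod_eq_prod,
    ENNReal.ofReal_prod_of_nonneg fun i _ => integral_nonneg (hf0 i)]
  exact Finset.prod_congr rfl fun i _ =>
    ofReal_integral_eq_lintegral_ofReal (hf i) (ae_of_all _ (hf0 i))

theorem pi_withDensity_ofReal (μ : ∀ i, Measure (E i)) [∀ i, SigmaFinite (μ i)]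
    {f : ∀ i, E i → ℝ} (hf : ∀ i, Integrable (f i) (μ i)) (hf0 : ∀ i x, 0 ≤ f i x) :
    Measure.pi (fun i => (μ i).withDensity fun x => ENNReal.ofReal (f i x))
      = (Measure.pi μ).withDensity fun x => ENNReal.ofReal (∏ i, f i (x i)) := by
  have : ∀ i, IsFiniteMeasure ((μ i).withDensity fun x => ENNReal.ofReal (f i x)) :=
    fun i => isFiniteMeasure_withDensity_ofReal (hf i).2
  refine Measure.pi_eq fun s hs => ?_
  rw [withDensity_apply _ (MeasurableSet.univ_pi hs), Measure.restrict_pi_pi]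
  simp_rw [withDensity_apply _ (hs _)]
  exact lintegral_pi_ofReal_prod _ (fun i => (hf i).restrict) hf0

theorem lintegral_indicator_one_mul {μ : Measure X} {S : Set X} (hS : MeasurableSet S)
    (f : X → ℝ≥0∞) : ∫⁻ x, S.indicator 1 x * f x ∂μ = ∫⁻ x in S, f x ∂μ := by
  rw [← lintegral_indicator hS]
  exact lintegral_congr fun x => by by_cases hx : x ∈ S <;> simp [hx]

theorem map_eval_pair_pi (μ : Measure X) [IsProbabilityMeasure μ] {i j : ι} (hij : i ≠ j) :
    (Measure.pi fun _ : ι => μ).map (fun c => (c i, c j)) = μ.prod μ := by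
  have hind : IndepFun (fun c : ι → X => c i) (fun c => c j) (Measure.pi fun _ : ι => μ) :=
    (iIndepFun_pi (μ := fun _ : ι => μ) (X := fun _ => id) fun _ => aemeasurable_id).indepFun hij
  have heval : ∀ k : ι, (Measure.pi fun _ : ι => μ).map (fun c => c k) = μ := fun k =>
    (measurePreserving_eval (fun _ : ι => μ) k).map_eq
  rwa [indepFun_iff_map_prod_eq_prod_map_map (measurable_pi_apply i).aemeasurable
    (measurable_pi_apply j).aemeasurable, heval, heval] at hind

theorem integral_comp_measurePreserving {μ : Measure X} {ν : Measure Y} {f : X → Y}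
    (hf : MeasurePreserving f μ ν) {g : Y → ℝ} (hg : AEStronglyMeasurable g ν) :
    ∫ x, g (f x) ∂μ = ∫ y, g y ∂ν := by
  rw [← hf.map_eq, integral_map hf.measurable.aemeasurable (by rwa [hf.map_eq])]

theorem measurePreserving_withDensity_comp {μ : Measure X} {ν : Measure Y} {f : X → Y}
    (hf : MeasurePreserving f μ ν) {g : Y → ℝ≥0∞} (hg : Measurable g) :
    MeasurePreserving f (μ.withDensity fun x => g (f x)) (ν.withDensity g) := by
  refine ⟨hf.measurable, Measure.ext fun s hs => ?_⟩
  rw [Measure.map_apply hf.measurable hs, withDensity_apply _ (hf.measurable hs),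
    withDensity_apply _ hs, hf.setLIntegral_comp_preimage hs hg]

theorem map_snd_withDensity_prod (μ : Measure X) (ν : Measure Y) [SFinite μ] [SFinite ν]
    {f : X × Y → ℝ≥0∞} (hf : Measurable f) :
    ((μ.prod ν).withDensity f).map Prod.snd = ν.withDensity fun y => ∫⁻ x, f (x, y) ∂μ := by
  ext s hs
  rw [Measure.map_apply measurable_snd hs, withDensity_apply _ (measurable_snd hs),
    withDensity_apply _ hs, ← Set.univ_prod, ← Measure.prod_restrict, Measure.restrict_univ,
    lintegral_prod_symm _ hf.aemeasurable]

theorem integrable_sum_comp_eval {ρ : Measure X} [IsFiniteMeasure ρ] {f : X → ℝ}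
    (hf : Integrable f ρ) :
    Integrable (fun y : ι → X => ∑ i, f (y i)) (Measure.pi fun _ => ρ) :=
  integrable_finsetSum _ fun _ _ => integrable_comp_eval hf

theorem integral_sum_comp_eval {ρ : Measure X} [IsProbabilityMeasure ρ] {f : X → ℝ}
    (hf : Integrable f ρ) :
    ∫ y : ι → X, ∑ i, f (y i) ∂(Measure.pi fun _ => ρ) = Fintype.card ι * ∫ x, f x ∂ρ := by
  have heval : ∀ i : ι, ∫ y : ι → X, f (y i) ∂(Measure.pi fun _ => ρ) = ∫ x, f x ∂ρ :=
    fun i => integral_comp_eval (μ := fun _ : ι => ρ) hf.1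
  rw [integral_finsetSum _ fun i _ => integrable_comp_eval (μ := fun _ : ι => ρ) hf]
  simp [heval]

theorem integral_add_add_one_sub {μ : Measure X} [IsProbabilityMeasure μ] {a b c : X → ℝ}
    (ha : Integrable a μ) (hb : Integrable b μ) (hc : Integrable c μ) :
    ∫ x, (a x + b x + 1 - c x) ∂μ = ∫ x, a x ∂μ + ∫ x, b x ∂μ + 1 - ∫ x, c x ∂μ := by
  have hab : Integrable (fun x => a x + b x) μ := ha.add hb
  have hab1 : Integrable (fun x => a x + b x + 1) μ := hab.add (integrable_const 1)
  rw [integral_sub hab1 hc, integral_add hab (integrable_const 1), integral_add ha hb]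
  simp

theorem integrable_withDensity_ofReal_iff {ν : Measure Y} {r : Y → ℝ} (hr : Measurable r)
    (hr0 : ∀ y, 0 ≤ r y) {f : Y → ℝ} :
    Integrable f (ν.withDensity fun y => ENNReal.ofReal (r y))
      ↔ Integrable (fun y => r y * f y) ν := by
  rw [integrable_withDensity_iff_integrable_smul' (by fun_prop) (by simp)]
  simp [ENNReal.toReal_ofReal (hr0 _)]

theorem integral_withDensity_ofReal {ν : Measure Y} {r : Y → ℝ} (hr : Measurable r)
    (hr0 : ∀ y, 0 ≤ r y) (f : Y → ℝ) :
    ∫ y, f y ∂(ν.withDensity fun y => ENNReal.ofReal (r y)) = ∫ y, r y * f y ∂ν := by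
  rw [integral_withDensity_eq_integral_toReal_smul (by fun_prop) (by simp)]
  simp [ENNReal.toReal_ofReal (hr0 _)]

theorem integral_llr_nonneg {μ ν : Measure Y} [IsProbabilityMeasure μ] [IsProbabilityMeasure ν]
    (hμν : μ ≪ ν) : 0 ≤ ∫ y, llr μ ν y ∂μ := by
  rw [← InformationTheory.toReal_klDiv_of_measure_eq hμν (by simp)]
  exact ENNReal.toReal_nonneg

-- `f ≤ llr μ ν + exp (f - llr μ ν)`, and the exponential has `μ`-integral at most `∫ exp f ∂ν`.
theorem integrable_of_integrable_exp {μ ν : Measure Y} [IsFiniteMeasure μ] [SigmaFinite ν]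
    (hμν : μ ≪ ν) (hllr : Integrable (llr μ ν) μ) {f : Y → ℝ} {a : ℝ}
    (hfa : ∀ᵐ y ∂μ, a ≤ f y) (hexp : Integrable (fun y => Real.exp (f y)) ν) :
    Integrable f μ := by
  have hf : AEStronglyMeasurable f μ := by
    have hlog : AEMeasurable (fun y => Real.log (Real.exp (f y))) ν := hexp.aemeasurable.log
    simp only [Real.log_exp] at hlog
    exact hlog.aestronglyMeasurable.mono_ac hμν
  have htilt : Integrable (fun y => Real.exp (f y - llr μ ν y)) μ := by
    have hrn : Integrable (fun y => (ν.rnDeriv μ y).toReal • Real.exp (f y)) μ :=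
      (integrable_withDensity_iff_integrable_smul' (ν.measurable_rnDeriv μ)
        (ν.rnDeriv_lt_top μ)).1 (hexp.mono_measure (ν.withDensity_rnDeriv_le μ))
    refine hrn.congr ?_
    filter_upwards [exp_neg_llr hμν] with y hy
    rw [← hy, smul_eq_mul, ← Real.exp_add, neg_add_eq_sub]
  refine Integrable.mono' ((integrable_const |a|).add (hllr.abs.add htilt)) hf ?_
  filter_upwards [hfa] with y hy
  have hexp_le := Real.add_one_le_exp (f y - llr μ ν y)
  have hexp_pos := Real.exp_pos (f y - llr μ ν y)
  rw [Real.norm_eq_abs, Pi.add_apply, Pi.add_apply, abs_le]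
  constructor <;> linarith [le_abs_self (llr μ ν y), neg_abs_le a, abs_nonneg a,
    abs_nonneg (llr μ ν y)]

/- Donsker–Varadhan; the gap is the divergence of `μ` from the measure `ν` tilted by `f`. -/
theorem integral_le_integral_llr_add_log {μ ν : Measure Y} [IsProbabilityMeasure μ]
    [IsProbabilityMeasure ν] (hμν : μ ≪ ν) (hllr : Integrable (llr μ ν) μ) {f : Y → ℝ}
    (hf : Integrable f μ) (hexp : Integrable (fun y => Real.exp (f y)) ν) :
    ∫ y, f y ∂μ ≤ ∫ y, llr μ ν y ∂μ + Real.log (∫ y, Real.exp (f y) ∂ν) := by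
  have := isProbabilityMeasure_tilted hexp
  have hgap := integral_llr_nonneg (hμν.trans (absolutelyContinuous_tilted hexp))
  rw [integral_llr_tilted_right hμν hf hexp hllr] at hgap
  linarith

theorem log_mul_measureReal_le {μ ν : Measure Y} [IsProbabilityMeasure μ]
    [IsProbabilityMeasure ν] (hμν : μ ≪ ν) (hllr : Integrable (llr μ ν) μ) {D : Set Y}
    (hD : MeasurableSet D) {M : ℝ} (hM : 0 < M) :
    Real.log M * μ.real D ≤ ∫ y, llr μ ν y ∂μ + M * ν.real D := by
  have hind : ∀ (ρ : Measure Y) [IsProbabilityMeasure ρ] (c : ℝ),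
      Integrable (D.indicator fun _ => c) ρ := fun ρ _ c => (integrable_const c).indicator hD
  have hexp_eq : (fun y => Real.exp (D.indicator (fun _ => Real.log M) y))
      = fun y => 1 + D.indicator (fun _ => M - 1) y := by
    funext y
    by_cases hy : y ∈ D <;> simp [hy, Real.exp_log hM]
  have hexp : Integrable (fun y => Real.exp (D.indicator (fun _ => Real.log M) y)) ν := by
    rw [hexp_eq]
    exact (integrable_const 1).add (hind ν _)
  have hint : ∫ y, Real.exp (D.indicator (fun _ => Real.log M) y) ∂ν
      = 1 + ν.real D * (M - 1) := by
    rw [hexp_eq, integral_add (integrable_const 1) (hind ν _), integral_indicator_const _ hD]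
    simp
  have hDV := integral_le_integral_llr_add_log hμν hllr (hind μ _) hexp
  have hlog := Real.log_le_sub_one_of_pos (integral_exp_pos hexp)
  rw [integral_indicator_const _ hD, smul_eq_mul] at hDV
  rw [hint] at hlog hDV
  linarith [measureReal_nonneg (μ := ν) (s := D)]

end General

section RandomCoding

variable {X Y : Type*}

/-- The output density of a channel `r` whose input is uniform on the codebook `c`. -/
noncomputable def codebookDensity {J : Type*} [Fintype J] (r : X → Y → ℝ) (c : J → X) (y : Y) :
    ℝ :=
  (Fintype.card J : ℝ)⁻¹ * ∑ j, r (c j) y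

theorem codebookDensity_nonneg {J : Type*} [Fintype J] {r : X → Y → ℝ} (hr : ∀ x y, 0 ≤ r x y)
    (c : J → X) (y : Y) : 0 ≤ codebookDensity r c y :=
  mul_nonneg (by positivity) (Finset.sum_nonneg fun _ _ => hr _ _)

theorem ofReal_codebookDensity {J : Type*} [Fintype J] [Nonempty J] {r : X → Y → ℝ}
    (hr : ∀ x y, 0 ≤ r x y) (c : J → X) (y : Y) :
    ENNReal.ofReal (codebookDensity r c y)
      = (Fintype.card J : ℝ≥0∞)⁻¹ * ∑ j, ENNReal.ofReal (r (c j) y) := by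
  rw [codebookDensity, ENNReal.ofReal_mul (by positivity),
    ENNReal.ofReal_sum_of_nonneg fun j _ => hr _ _,
    ENNReal.ofReal_inv_of_pos (by exact_mod_cast Fintype.card_pos), ENNReal.ofReal_natCast]

/-- An upper bound for the conditional mean of the density `codebookDensity r c y` of a random
codebook `c` of size `N`, given that one of the codewords is `x`. -/
noncomputable def smoothedOutput (r : X → Y → ℝ) (w : Y → ℝ) (N : ℝ) (x : X) (y : Y) : ℝ :=
  r x y / N + w y

/-- The bound for the contribution of the codeword `c j` to `klFun (codebookDensity r c y)` that
comes from the tangent of `log` at `smoothedOutput r w (card J) (c j) y`. -/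
noncomputable def klTangentTerm {J : Type*} [Fintype J] (r : X → Y → ℝ) (w : Y → ℝ) (c : J → X)
    (y : Y) (j : J) : ℝ :=
  r (c j) y * Real.log (smoothedOutput r w (Fintype.card J) (c j) y)
    + r (c j) y / smoothedOutput r w (Fintype.card J) (c j) y * codebookDensity r c y
    + 1 - 2 * r (c j) y

theorem norm_mul_log_div_add_le {r w N : ℝ} (hr : 0 ≤ r) (hw : 0 < w) (hN : 1 ≤ N) :
    ‖r * Real.log (r / N + w)‖ ≤
      Real.log 2 * r + (‖r * Real.log r‖ + ‖r * Real.log w‖) := by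
  rcases hr.eq_or_lt with rfl | hr
  · simp
  have hrN : r / N ≤ r := div_le_self hr.le hN
  have hrN0 : 0 < r / N := by positivity
  have hlower : Real.log w ≤ Real.log (r / N + w) := Real.log_le_log hw (by linarith)
  have hupper : Real.log (r / N + w) ≤ Real.log 2 + Real.log (max r w) := by
    rw [← Real.log_mul (by norm_num) (by positivity)]
    exact Real.log_le_log (by positivity) (by linarith [le_max_left r w, le_max_right r w])
  have hmax : Real.log (max r w) ≤ |Real.log r| + |Real.log w| := by
    rcases max_choice r w with h | h <;> rw [h] <;>
      linarith [le_abs_self (Real.log r), le_abs_self (Real.log w), abs_nonneg (Real.log r),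
        abs_nonneg (Real.log w)]
  have habs : |Real.log (r / N + w)| ≤ Real.log 2 + (|Real.log r| + |Real.log w|) := by
    rw [abs_le]
    constructor <;> linarith [neg_abs_le (Real.log w), abs_nonneg (Real.log r),
      Real.log_nonneg (one_le_two (α := ℝ))]
  simp only [norm_mul, Real.norm_of_nonneg hr.le, Real.norm_eq_abs]
  linarith [mul_le_mul_of_nonneg_left habs hr.le]

-- Jensen's inequality is replaced by the tangent bound `log g ≤ log a + g / a - 1` at a point `a`
-- depending on `j`, which keeps every term integrable.
theorem klFun_average_le {J : Type*} [Fintype J] [Nonempty J] {ρ a : J → ℝ} (hρ : ∀ j, 0 ≤ ρ j)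
    (ha : ∀ j, 0 < a j) {g : ℝ} (hg : g = (Fintype.card J : ℝ)⁻¹ * ∑ j, ρ j) :
    InformationTheory.klFun g ≤ (Fintype.card J : ℝ)⁻¹ *
      ∑ j, (ρ j * Real.log (a j) + ρ j / a j * g + 1 - 2 * ρ j) := by
  have hN : (0 : ℝ) < Fintype.card J := by exact_mod_cast Fintype.card_pos
  have hsum : InformationTheory.klFun g
      = (Fintype.card J : ℝ)⁻¹ * ∑ j, (ρ j * Real.log g + 1 - ρ j) := by
    rw [Finset.sum_sub_distrib, Finset.sum_add_distrib, ← Finset.sum_mul,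
      InformationTheory.klFun_apply, mul_sub, mul_add, ← mul_assoc, ← hg]
    simp [hN.ne']
  rw [hsum]
  refine mul_le_mul_of_nonneg_left (Finset.sum_le_sum fun j _ => ?_) (by positivity)
  rcases (hρ j).eq_or_lt with h0 | h0
  · simp [← h0]
  have hgpos : 0 < g := by
    have := h0.trans_le (Finset.single_le_sum (fun i _ => hρ i) (Finset.mem_univ j))
    rw [hg]
    positivity
  have htangent := Real.log_le_sub_one_of_pos (div_pos hgpos (ha j))
  rw [Real.log_div hgpos.ne' (ha j).ne'] at htangent
  have hmul := mul_le_mul_of_nonneg_left htangent h0.le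
  rw [mul_sub, mul_sub, ← mul_div_assoc, ← div_mul_eq_mul_div] at hmul
  linarith

variable [MeasurableSpace X] [MeasurableSpace Y]

/-- `r x` is the output density, with respect to `ν`, of a channel with input `x`, and `w` is its
output density when the input has law `μ`. The last two conditions make the mutual information of
input and output finite. -/
structure IsChannelDensity (μ : Measure X) (ν : Measure Y) (r : X → Y → ℝ) (w : Y → ℝ) : Prop where
  measurable : Measurable fun q : X × Y => r q.1 q.2
  nonneg : ∀ x y, 0 ≤ r x y
  measurable_output : Measurable w
  output_pos : ∀ y, 0 < w y
  lintegral_eq_one : ∀ᵐ x ∂μ, ∫⁻ y, ENNReal.ofReal (r x y) ∂ν = 1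
  lintegral_input : ∀ᵐ y ∂ν, ∫⁻ x, ENNReal.ofReal (r x y) ∂μ = ENNReal.ofReal (w y)
  integrable_mul_log : Integrable (fun q : X × Y => r q.1 q.2 * Real.log (r q.1 q.2)) (μ.prod ν)
  integrable_mul_log_output :
    Integrable (fun q : X × Y => r q.1 q.2 * Real.log (w q.2)) (μ.prod ν)

theorem measurePreserving_codebook_single {J : Type*} [Fintype J] (μ : Measure X)
    [IsProbabilityMeasure μ] (ν : Measure Y) [SFinite ν] (j : J) :
    MeasurePreserving (fun q : (J → X) × Y => (q.1 j, q.2)) ((Measure.pi fun _ : J => μ).prod ν)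
      (μ.prod ν) :=
  (measurePreserving_eval (fun _ : J => μ) j).prod (MeasurePreserving.id ν)

namespace IsChannelDensity

variable {μ : Measure X} {ν : Measure Y} {r : X → Y → ℝ} {w : Y → ℝ} {J : Type*} [Fintype J]

theorem smoothedOutput_pos (h : IsChannelDensity μ ν r w) {N : ℝ} (hN : 0 ≤ N) (x : X) (y : Y) :
    0 < smoothedOutput r w N x y :=
  add_pos_of_nonneg_of_pos (div_nonneg (h.nonneg x y) hN) (h.output_pos y)

theorem measurable_smoothedOutput (h : IsChannelDensity μ ν r w) (N : ℝ) :
    Measurable fun q : X × Y => smoothedOutput r w N q.1 q.2 :=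
  (h.measurable.div_const N).add (h.measurable_output.comp measurable_snd)

theorem measurable_codebookDensity (h : IsChannelDensity μ ν r w) :
    Measurable fun q : (J → X) × Y => codebookDensity r q.1 q.2 :=
  (Finset.measurable_fun_sum _ fun j _ => h.measurable.comp
    (((measurable_pi_apply j).comp measurable_fst).prodMk measurable_snd)).const_mul _

theorem measurable_mul_log_smoothedOutput (h : IsChannelDensity μ ν r w) (N : ℝ) :
    Measurable fun q : X × Y => r q.1 q.2 * Real.log (smoothedOutput r w N q.1 q.2) :=
  h.measurable.mul (h.measurable_smoothedOutput N).log

theorem ofReal_smoothedOutput (h : IsChannelDensity μ ν r w) [Nonempty J] (x : X) (y : Y) :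
    ENNReal.ofReal (smoothedOutput r w (Fintype.card J) x y)
      = (Fintype.card J : ℝ≥0∞)⁻¹ * ENNReal.ofReal (r x y) + ENNReal.ofReal (w y) := by
  have hN : (0 : ℝ) < Fintype.card J := by exact_mod_cast Fintype.card_pos
  rw [smoothedOutput, ENNReal.ofReal_add (div_nonneg (h.nonneg _ _) hN.le) (h.output_pos _).le,
    ENNReal.ofReal_div_of_pos hN, ENNReal.ofReal_natCast, ENNReal.div_eq_inv_mul]

theorem div_smoothedOutput_mul_codebookDensity_nonneg (h : IsChannelDensity μ ν r w) {N : ℝ}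
    (hN : 0 ≤ N) (c : J → X) (x : X) (y : Y) :
    0 ≤ r x y / smoothedOutput r w N x y * codebookDensity r c y :=
  mul_nonneg (div_nonneg (h.nonneg _ _) (h.smoothedOutput_pos hN _ _).le)
    (codebookDensity_nonneg h.nonneg _ _)

theorem measurable_div_smoothedOutput_mul_codebookDensity (h : IsChannelDensity μ ν r w) (j : J)
    (N : ℝ) : Measurable fun q : (J → X) × Y =>
      r (q.1 j) q.2 / smoothedOutput r w N (q.1 j) q.2 * codebookDensity r q.1 q.2 :=
  have heval : Measurable fun q : (J → X) × Y => (q.1 j, q.2) :=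
    ((measurable_pi_apply j).comp measurable_fst).prodMk measurable_snd
  ((h.measurable.comp heval).div ((h.measurable_smoothedOutput N).comp heval)).mul
    h.measurable_codebookDensity

variable [IsProbabilityMeasure μ] [SFinite ν]

theorem lintegral_prod_eq_one (h : IsChannelDensity μ ν r w) :
    ∫⁻ q, ENNReal.ofReal (r q.1 q.2) ∂(μ.prod ν) = 1 := by
  rw [lintegral_prod _ h.measurable.ennreal_ofReal.aemeasurable,
    lintegral_congr_ae h.lintegral_eq_one]
  simp

theorem integrable (h : IsChannelDensity μ ν r w) :
    Integrable (fun q : X × Y => r q.1 q.2) (μ.prod ν) := by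
  rw [← lintegral_ofReal_ne_top_iff_integrable h.measurable.aestronglyMeasurable
    (ae_of_all _ fun q => h.nonneg _ _), h.lintegral_prod_eq_one]
  simp

theorem integral_prod_eq_one (h : IsChannelDensity μ ν r w) :
    ∫ q, r q.1 q.2 ∂(μ.prod ν) = 1 := by
  rw [integral_eq_lintegral_of_nonneg_ae (ae_of_all _ fun q => h.nonneg _ _)
    h.measurable.aestronglyMeasurable, h.lintegral_prod_eq_one]
  simp

theorem integrable_mul_log_dominating (h : IsChannelDensity μ ν r w) :
    Integrable (fun q : X × Y => Real.log 2 * r q.1 q.2 + (‖r q.1 q.2 * Real.log (r q.1 q.2)‖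
      + ‖r q.1 q.2 * Real.log (w q.2)‖)) (μ.prod ν) :=
  (h.integrable.const_mul _).add (h.integrable_mul_log.norm.add h.integrable_mul_log_output.norm)

theorem integrable_mul_log_smoothedOutput (h : IsChannelDensity μ ν r w) {N : ℝ} (hN : 1 ≤ N) :
    Integrable (fun q : X × Y => r q.1 q.2 * Real.log (smoothedOutput r w N q.1 q.2))
      (μ.prod ν) :=
  h.integrable_mul_log_dominating.mono' (h.measurable_mul_log_smoothedOutput N).aestronglyMeasurable
    (ae_of_all _ fun _ => norm_mul_log_div_add_le (h.nonneg _ _) (h.output_pos _) hN)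

theorem tendsto_integral_mul_log_smoothedOutput (h : IsChannelDensity μ ν r w) :
    Tendsto (fun N : ℕ => ∫ q, r q.1 q.2 * Real.log (smoothedOutput r w N q.1 q.2) ∂(μ.prod ν))
      atTop (𝓝 (∫ q, r q.1 q.2 * Real.log (w q.2) ∂(μ.prod ν))) := by
  refine tendsto_integral_filter_of_dominated_convergence _ (Eventually.of_forall fun N : ℕ =>
    (h.measurable_mul_log_smoothedOutput N).aestronglyMeasurable) ?_
    h.integrable_mul_log_dominating (ae_of_all _ fun q => ?_)
  · filter_upwards [eventually_ge_atTop 1] with N hN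
    exact ae_of_all _ fun q =>
      norm_mul_log_div_add_le (h.nonneg _ _) (h.output_pos _) (by exact_mod_cast hN)
  · have hlim : Tendsto (fun N : ℕ => smoothedOutput r w N q.1 q.2) atTop (𝓝 (0 + w q.2)) :=
      (tendsto_const_div_atTop_nhds_zero_nat _).add_const _
    rw [zero_add] at hlim
    exact (hlim.log (h.output_pos _).ne').const_mul _

theorem lintegral_codebook_pair (h : IsChannelDensity μ ν r w) {i j : J} (hij : i ≠ j)
    {u : X × Y → ℝ≥0∞} (hu : Measurable u) :
    ∫⁻ q, u (q.1 i, q.2) * ENNReal.ofReal (r (q.1 j) q.2) ∂((Measure.pi fun _ : J => μ).prod ν)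
      = ∫⁻ q, u q * ENNReal.ofReal (w q.2) ∂(μ.prod ν) := by
  have hpair : MeasurePreserving (fun q : (J → X) × Y => ((q.1 i, q.1 j), q.2))
      ((Measure.pi fun _ : J => μ).prod ν) ((μ.prod μ).prod ν) :=
    MeasurePreserving.prod
      ⟨(measurable_pi_apply i).prodMk (measurable_pi_apply j), map_eval_pair_pi μ hij⟩
      (MeasurePreserving.id ν)
  have hmeas : Measurable fun q : (X × X) × Y => u (q.1.1, q.2) * ENNReal.ofReal (r q.1.2 q.2) :=
    (hu.comp (measurable_fst.fst.prodMk measurable_snd)).mul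
      (h.measurable.comp (measurable_fst.snd.prodMk measurable_snd)).ennreal_ofReal
  have hmeas' : Measurable fun q : X × Y => u q * ENNReal.ofReal (w q.2) :=
    hu.mul (h.measurable_output.comp measurable_snd).ennreal_ofReal
  rw [hpair.lintegral_comp hmeas, lintegral_prod_symm _ hmeas.aemeasurable,
    lintegral_prod_symm _ hmeas'.aemeasurable]
  refine lintegral_congr_ae ?_
  filter_upwards [h.lintegral_input] with y hy
  have hry : Measurable fun x => r x y := h.measurable.comp (measurable_id.prodMk measurable_const)
  have huy : Measurable fun x => u (x, y) := hu.comp (measurable_id.prodMk measurable_const)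
  rw [lintegral_prod_mul (f := fun x => u (x, y)) huy.aemeasurable hry.ennreal_ofReal.aemeasurable,
    hy, lintegral_mul_const _ huy]

theorem lintegral_mul_codebookDensity_le (h : IsChannelDensity μ ν r w) [Nonempty J] (j : J)
    {u : X × Y → ℝ≥0∞} (hu : Measurable u) :
    ∫⁻ q, u (q.1 j, q.2) * ENNReal.ofReal (codebookDensity r q.1 q.2)
        ∂((Measure.pi fun _ : J => μ).prod ν)
      ≤ ∫⁻ q, u q * ENNReal.ofReal (smoothedOutput r w (Fintype.card J) q.1 q.2) ∂(μ.prod ν) := by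
  classical
  set N := Fintype.card J
  have hev := fun i : J => measurePreserving_codebook_single μ ν i
  have hur : Measurable fun q : X × Y => u q * ENNReal.ofReal (r q.1 q.2) :=
    hu.mul h.measurable.ennreal_ofReal
  have hterm : ∀ i : J, Measurable fun q : (J → X) × Y =>
      u (q.1 j, q.2) * ENNReal.ofReal (r (q.1 i) q.2) := fun i =>
    (hu.comp (hev j).measurable).mul (h.measurable.comp (hev i).measurable).ennreal_ofReal
  have hoff : ∀ i ∈ Finset.univ.erase j, ∫⁻ q, u (q.1 j, q.2) * ENNReal.ofReal (r (q.1 i) q.2)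
      ∂((Measure.pi fun _ : J => μ).prod ν) = ∫⁻ q, u q * ENNReal.ofReal (w q.2) ∂(μ.prod ν) :=
    fun i hi => h.lintegral_codebook_pair (Finset.ne_of_mem_erase hi).symm hu
  have hcard : ((Finset.univ.erase j).card : ℝ≥0∞) ≤ N := by
    exact_mod_cast Finset.card_le_univ _
  calc
    _ = ∫⁻ q, (N : ℝ≥0∞)⁻¹ * ∑ i, u (q.1 j, q.2) * ENNReal.ofReal (r (q.1 i) q.2)
        ∂((Measure.pi fun _ : J => μ).prod ν) := by
      simp_rw [ofReal_codebookDensity h.nonneg, mul_left_comm (u _), Finset.mul_sum, N]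
    _ = (N : ℝ≥0∞)⁻¹ * (∫⁻ q, u q * ENNReal.ofReal (r q.1 q.2) ∂(μ.prod ν)
        + (Finset.univ.erase j).card * ∫⁻ q, u q * ENNReal.ofReal (w q.2) ∂(μ.prod ν)) := by
      rw [lintegral_const_mul _ (Finset.measurable_fun_sum _ fun i _ => hterm i),
        lintegral_finsetSum _ fun i _ => hterm i, ← Finset.add_sum_erase _ _ (Finset.mem_univ j),
        Finset.sum_congr rfl hoff, Finset.sum_const, nsmul_eq_mul, (hev j).lintegral_comp hur]
    _ ≤ (N : ℝ≥0∞)⁻¹ * (∫⁻ q, u q * ENNReal.ofReal (r q.1 q.2) ∂(μ.prod ν)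
        + N * ∫⁻ q, u q * ENNReal.ofReal (w q.2) ∂(μ.prod ν)) := by gcongr
    _ = ∫⁻ q, ((N : ℝ≥0∞)⁻¹ * (u q * ENNReal.ofReal (r q.1 q.2)) + u q * ENNReal.ofReal (w q.2))
        ∂(μ.prod ν) := by
      rw [lintegral_add_left (hur.const_mul _), lintegral_const_mul _ hur, mul_add, ← mul_assoc,
        ENNReal.inv_mul_cancel (by simp [N]) (by simp), one_mul]
    _ = _ := by simp only [h.ofReal_smoothedOutput, mul_add, mul_left_comm (u _), N]

theorem lintegral_div_smoothedOutput_mul_codebookDensity_le_one (h : IsChannelDensity μ ν r w)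
    [Nonempty J] (j : J) :
    ∫⁻ q, ENNReal.ofReal (r (q.1 j) q.2 / smoothedOutput r w (Fintype.card J) (q.1 j) q.2
        * codebookDensity r q.1 q.2) ∂((Measure.pi fun _ : J => μ).prod ν) ≤ 1 := by
  have hpos : ∀ x y, 0 < smoothedOutput r w (Fintype.card J) x y :=
    h.smoothedOutput_pos (by positivity)
  have hu : Measurable fun q : X × Y =>
      ENNReal.ofReal (r q.1 q.2 / smoothedOutput r w (Fintype.card J) q.1 q.2) :=
    (h.measurable.div (h.measurable_smoothedOutput _)).ennreal_ofReal
  simp_rw [ENNReal.ofReal_mul (div_nonneg (h.nonneg _ _) (hpos _ _).le)]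
  refine (h.lintegral_mul_codebookDensity_le j hu).trans_eq ?_
  rw [← h.lintegral_prod_eq_one]
  refine lintegral_congr fun q => ?_
  rw [← ENNReal.ofReal_mul (div_nonneg (h.nonneg _ _) (hpos _ _).le),
    div_mul_cancel₀ _ (hpos _ _).ne']

theorem integrable_div_smoothedOutput_mul_codebookDensity (h : IsChannelDensity μ ν r w)
    [Nonempty J] (j : J) :
    Integrable (fun q : (J → X) × Y => r (q.1 j) q.2 / smoothedOutput r w (Fintype.card J) (q.1 j)
      q.2 * codebookDensity r q.1 q.2) ((Measure.pi fun _ : J => μ).prod ν) := by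
  rw [← lintegral_ofReal_ne_top_iff_integrable
    (h.measurable_div_smoothedOutput_mul_codebookDensity j _).aestronglyMeasurable
    (ae_of_all _ fun _ =>
      h.div_smoothedOutput_mul_codebookDensity_nonneg (Nat.cast_nonneg _) _ _ _)]
  exact ((h.lintegral_div_smoothedOutput_mul_codebookDensity_le_one j).trans_lt
    ENNReal.one_lt_top).ne

theorem integral_div_smoothedOutput_mul_codebookDensity_le_one (h : IsChannelDensity μ ν r w)
    [Nonempty J] (j : J) :
    ∫ q, r (q.1 j) q.2 / smoothedOutput r w (Fintype.card J) (q.1 j) q.2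
      * codebookDensity r q.1 q.2 ∂((Measure.pi fun _ : J => μ).prod ν) ≤ 1 := by
  rw [integral_eq_lintegral_of_nonneg_ae (ae_of_all _ fun _ =>
      h.div_smoothedOutput_mul_codebookDensity_nonneg (Nat.cast_nonneg _) _ _ _)
    (h.measurable_div_smoothedOutput_mul_codebookDensity j _).aestronglyMeasurable]
  exact ENNReal.toReal_le_of_le_ofReal zero_le_one
    (by simpa using h.lintegral_div_smoothedOutput_mul_codebookDensity_le_one j)

theorem integrable_two_mul_codeword (h : IsChannelDensity μ ν r w) (j : J) :
    Integrable (fun q : (J → X) × Y => 2 * r (q.1 j) q.2) ((Measure.pi fun _ : J => μ).prod ν) :=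
  ((measurePreserving_codebook_single μ ν j).integrable_comp_of_integrable h.integrable).const_mul 2

theorem integrable_mul_log_codeword (h : IsChannelDensity μ ν r w) [Nonempty J] (j : J) :
    Integrable (fun q : (J → X) × Y =>
      r (q.1 j) q.2 * Real.log (smoothedOutput r w (Fintype.card J) (q.1 j) q.2))
      ((Measure.pi fun _ : J => μ).prod ν) :=
  (measurePreserving_codebook_single μ ν j).integrable_comp_of_integrable
    (h.integrable_mul_log_smoothedOutput (by exact_mod_cast Fintype.card_pos))

variable [IsProbabilityMeasure ν] [Nonempty J]

theorem integrable_klTangentTerm (h : IsChannelDensity μ ν r w) (j : J) :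
    Integrable (fun q : (J → X) × Y => klTangentTerm r w q.1 q.2 j)
      ((Measure.pi fun _ : J => μ).prod ν) :=
  (((h.integrable_mul_log_codeword j).add
    (h.integrable_div_smoothedOutput_mul_codebookDensity j)).add (integrable_const 1)).sub
    (h.integrable_two_mul_codeword j)

theorem integral_klTangentTerm_le (h : IsChannelDensity μ ν r w) (j : J) :
    ∫ q, klTangentTerm r w q.1 q.2 j ∂((Measure.pi fun _ : J => μ).prod ν)
      ≤ ∫ q, r q.1 q.2 * Real.log (smoothedOutput r w (Fintype.card J) q.1 q.2) ∂(μ.prod ν) := by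
  have hlog := h.integrable_mul_log_codeword j
  have hratio := h.integrable_div_smoothedOutput_mul_codebookDensity j
  have hratio_le := h.integral_div_smoothedOutput_mul_codebookDensity_le_one j
  simp only [klTangentTerm]
  rw [integral_add_add_one_sub hlog hratio (h.integrable_two_mul_codeword j), integral_const_mul,
    integral_comp_measurePreserving (measurePreserving_codebook_single μ ν j)
      (h.measurable_mul_log_smoothedOutput _).aestronglyMeasurable,
    integral_comp_measurePreserving (measurePreserving_codebook_single μ ν j)
      h.measurable.aestronglyMeasurable, h.integral_prod_eq_one]
  linarith

theorem lintegral_klFun_codebookDensity_le (h : IsChannelDensity μ ν r w) :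
    ∫⁻ q, ENNReal.ofReal (InformationTheory.klFun (codebookDensity r q.1 q.2))
        ∂((Measure.pi fun _ : J => μ).prod ν)
      ≤ ENNReal.ofReal (∫ q, r q.1 q.2 *
          Real.log (smoothedOutput r w (Fintype.card J) q.1 q.2) ∂(μ.prod ν)) := by
  have hbound (q : (J → X) × Y) : InformationTheory.klFun (codebookDensity r q.1 q.2)
      ≤ (Fintype.card J : ℝ)⁻¹ * ∑ j, klTangentTerm r w q.1 q.2 j :=
    klFun_average_le (fun _ => h.nonneg _ _)
      (fun _ => h.smoothedOutput_pos (Nat.cast_nonneg _) _ _) rfl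
  refine (lintegral_mono fun q => ENNReal.ofReal_le_ofReal (hbound q)).trans ?_
  rw [← ofReal_integral_eq_lintegral_ofReal
    ((integrable_finsetSum _ fun j _ => h.integrable_klTangentTerm j).const_mul _)
    (ae_of_all _ fun q =>
      (InformationTheory.klFun_nonneg (codebookDensity_nonneg h.nonneg _ _)).trans (hbound q)),
    integral_const_mul, integral_finsetSum _ fun j _ => h.integrable_klTangentTerm j]
  refine ENNReal.ofReal_le_ofReal ((mul_le_mul_of_nonneg_left
    (Finset.sum_le_sum fun j _ => h.integral_klTangentTerm_le j) (by positivity)).trans_eq ?_)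
  rw [Finset.sum_const, Finset.card_univ, nsmul_eq_mul, inv_mul_cancel_left₀ (by positivity)]

end IsChannelDensity

end RandomCoding

section TypicalSetDecoder

variable {X Y 𝓜 𝓚 : Type*} [MeasurableSpace X] [MeasurableSpace Y]

/-- The typical-set decoder: some message whose codeword under the key `k` is jointly typical with
the output `y`, and an arbitrary message if there is none. -/
noncomputable def typicalDecode [Nonempty 𝓜] (S : Set (X × Y)) (c : 𝓜 × 𝓚 → X) (y : Y) (k : 𝓚) :
    𝓜 :=
  Classical.epsilon fun m => (c (m, k), y) ∈ S

/-- The union bound for the error of the typical-set decoder: the codeword `c j` is not typical, or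
the codeword of another message under the same key is. -/
noncomputable def unionBoundError [Fintype 𝓜] [DecidableEq 𝓜] (r : X → Y → ℝ) (S : Set (X × Y))
    (c : 𝓜 × 𝓚 → X) (y : Y) (j : 𝓜 × 𝓚) : ℝ≥0∞ :=
  Sᶜ.indicator 1 (c j, y) * ENNReal.ofReal (r (c j) y)
    + ∑ m ∈ Finset.univ.erase j.1, S.indicator 1 (c (m, j.2), y) * ENNReal.ofReal (r (c j) y)

/-- The weighted sum of the divergence between the output law and the reference measure `ν` and of
the average union bound for the decoding error, as a function of the codebook. -/
noncomputable def codebookCost [Fintype 𝓜] [DecidableEq 𝓜] [Fintype 𝓚] (r : X → Y → ℝ)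
    (S : Set (X × Y)) (ν : Measure Y) (a b : ℝ≥0∞) (c : 𝓜 × 𝓚 → X) : ℝ≥0∞ :=
  a * ∫⁻ y, ENNReal.ofReal (InformationTheory.klFun (codebookDensity r c y)) ∂ν
    + b * ((Fintype.card (𝓜 × 𝓚) : ℝ≥0∞)⁻¹ * ∑ j, ∫⁻ y, unionBoundError r S c y j ∂ν)

theorem measurableSet_typicalDecode [Finite 𝓜] [Nonempty 𝓜] {S : Set (X × Y)}
    (hS : MeasurableSet S) (c : 𝓜 × 𝓚 → X) (k : 𝓚) (m : 𝓜) :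
    MeasurableSet {y | typicalDecode S c y k = m} := by
  have htyp : Measurable fun (y : Y) (m : 𝓜) => (c (m, k), y) ∈ S :=
    measurable_pi_lambda _ fun m =>
      measurable_mem.2 hS |>.comp (measurable_const.prodMk measurable_id)
  exact htyp (Set.toFinite {s : 𝓜 → Prop | Classical.epsilon s = m}).measurableSet

theorem setLIntegral_typicalDecode_ne_le [Fintype 𝓜] [DecidableEq 𝓜] [Nonempty 𝓜] (r : X → Y → ℝ)
    (ν : Measure Y) {S : Set (X × Y)} (hS : MeasurableSet S) (c : 𝓜 × 𝓚 → X) (j : 𝓜 × 𝓚) :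
    ∫⁻ y in {y | typicalDecode S c y j.2 ≠ j.1}, ENNReal.ofReal (r (c j) y) ∂ν
      ≤ ∫⁻ y, unionBoundError r S c y j ∂ν := by
  have hmeas : MeasurableSet {y | typicalDecode S c y j.2 ≠ j.1} :=
    (measurableSet_typicalDecode hS c j.2 j.1).compl
  rw [← lintegral_indicator hmeas]
  refine lintegral_mono (Set.indicator_le' (fun y hy => ?_) fun _ _ => zero_le)
  by_cases hj : (c j, y) ∈ S
  · have hdec : (c (typicalDecode S c y j.2, j.2), y) ∈ S := Classical.epsilon_spec (⟨j.1, hj⟩ :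
      ∃ m, (c (m, j.2), y) ∈ S)
    refine le_add_left (le_trans ?_ (Finset.single_le_sum (fun _ _ => zero_le)
      (Finset.mem_erase.2 ⟨hy, Finset.mem_univ _⟩)))
    rw [Set.indicator_of_mem hdec, Pi.one_apply, one_mul]
  · refine le_add_right ?_
    rw [Set.indicator_of_mem (Set.mem_compl hj), Pi.one_apply, one_mul]

namespace IsChannelDensity

variable [Fintype 𝓜] [DecidableEq 𝓜] {μ : Measure X} {ν : Measure Y} {r : X → Y → ℝ} {w : Y → ℝ}
  {S : Set (X × Y)}

theorem measurable_unionBoundError (h : IsChannelDensity μ ν r w) (hS : MeasurableSet S)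
    (j : 𝓜 × 𝓚) : Measurable fun q : (𝓜 × 𝓚 → X) × Y => unionBoundError r S q.1 q.2 j := by
  have heval (i : 𝓜 × 𝓚) : Measurable fun q : (𝓜 × 𝓚 → X) × Y => (q.1 i, q.2) :=
    ((measurable_pi_apply i).comp measurable_fst).prodMk measurable_snd
  have hr : Measurable fun q : (𝓜 × 𝓚 → X) × Y => ENNReal.ofReal (r (q.1 j) q.2) :=
    (h.measurable.comp (heval j)).ennreal_ofReal
  exact (((measurable_one.indicator hS.compl).comp (heval j)).mul hr).add
    (Finset.measurable_fun_sum _ fun m _ =>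
      ((measurable_one.indicator hS).comp (heval (m, j.2))).mul hr)

theorem measurable_codebookCost [SFinite ν] [Fintype 𝓚] (h : IsChannelDensity μ ν r w)
    (hS : MeasurableSet S) (a b : ℝ≥0∞) :
    Measurable fun c : 𝓜 × 𝓚 → X => codebookCost r S ν a b c :=
  (((InformationTheory.measurable_klFun.comp
    h.measurable_codebookDensity).ennreal_ofReal.lintegral_prod_right').const_mul _).add
    (((Finset.measurable_fun_sum _ fun j _ =>
      (h.measurable_unionBoundError hS j).lintegral_prod_right').const_mul _).const_mul _)

variable [IsProbabilityMeasure μ] [SFinite ν]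

theorem setLIntegral_output_le (h : IsChannelDensity μ ν r w) {t : ℝ} (ht : 0 < t) :
    ∫⁻ q in {q : X × Y | t * w q.2 < r q.1 q.2}, ENNReal.ofReal (w q.2) ∂(μ.prod ν)
      ≤ ENNReal.ofReal (1 / t) := by
  have hS : MeasurableSet {q : X × Y | t * w q.2 < r q.1 q.2} :=
    measurableSet_lt ((h.measurable_output.comp measurable_snd).const_mul t) h.measurable
  have hle (q : X × Y) (hq : t * w q.2 < r q.1 q.2) :
      ENNReal.ofReal (w q.2) ≤ ENNReal.ofReal (1 / t) * ENNReal.ofReal (r q.1 q.2) := by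
    rw [← ENNReal.ofReal_mul (by positivity), one_div, ← div_eq_inv_mul]
    exact ENNReal.ofReal_le_ofReal ((le_div_iff₀' ht).2 hq.le)
  refine ((setLIntegral_mono' hS hle).trans (setLIntegral_le_lintegral _ _)).trans_eq ?_
  rw [lintegral_const_mul _ h.measurable.ennreal_ofReal, h.lintegral_prod_eq_one, mul_one]

variable [Fintype 𝓚]

theorem lintegral_unionBoundError_le (h : IsChannelDensity μ ν r w) (hS : MeasurableSet S)
    (j : 𝓜 × 𝓚) :
    ∫⁻ q, unionBoundError r S q.1 q.2 j ∂((Measure.pi fun _ : 𝓜 × 𝓚 => μ).prod ν)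
      ≤ ∫⁻ q in Sᶜ, ENNReal.ofReal (r q.1 q.2) ∂(μ.prod ν)
        + Fintype.card 𝓜 * ∫⁻ q in S, ENNReal.ofReal (w q.2) ∂(μ.prod ν) := by
  have hev (i : 𝓜 × 𝓚) := measurePreserving_codebook_single μ ν i
  have hmul {T : Set (X × Y)} (hT : MeasurableSet T) (i : 𝓜 × 𝓚) :
      Measurable fun q : (𝓜 × 𝓚 → X) × Y =>
        T.indicator 1 (q.1 i, q.2) * ENNReal.ofReal (r (q.1 j) q.2) :=
    ((measurable_one.indicator hT).comp (hev i).measurable).mul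
      (h.measurable.comp (hev j).measurable).ennreal_ofReal
  have hsent : ∫⁻ q, Sᶜ.indicator 1 (q.1 j, q.2) * ENNReal.ofReal (r (q.1 j) q.2)
      ∂((Measure.pi fun _ : 𝓜 × 𝓚 => μ).prod ν)
      = ∫⁻ q in Sᶜ, ENNReal.ofReal (r q.1 q.2) ∂(μ.prod ν) := by
    rw [← lintegral_indicator_one_mul hS.compl]
    exact (hev j).lintegral_comp
      ((measurable_one.indicator hS.compl).mul h.measurable.ennreal_ofReal)
  have hother (m : 𝓜) (hm : m ∈ Finset.univ.erase j.1) :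
      ∫⁻ q, S.indicator 1 (q.1 (m, j.2), q.2) * ENNReal.ofReal (r (q.1 j) q.2)
        ∂((Measure.pi fun _ : 𝓜 × 𝓚 => μ).prod ν)
      = ∫⁻ q in S, ENNReal.ofReal (w q.2) ∂(μ.prod ν) := by
    have hne : (m, j.2) ≠ j := fun he => Finset.ne_of_mem_erase hm (congrArg Prod.fst he)
    rw [h.lintegral_codebook_pair hne (measurable_one.indicator hS),
      lintegral_indicator_one_mul hS]
  simp only [unionBoundError]
  rw [lintegral_add_left (hmul hS.compl j), lintegral_finsetSum _ fun m _ => hmul hS (m, j.2),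
    hsent, Finset.sum_congr rfl hother, Finset.sum_const, nsmul_eq_mul]
  gcongr
  exact Finset.card_le_univ _

theorem lintegral_codebookCost_le [IsProbabilityMeasure ν] [Nonempty 𝓜] [Nonempty 𝓚]
    (h : IsChannelDensity μ ν r w) (hS : MeasurableSet S) (a b : ℝ≥0∞) :
    ∫⁻ c, codebookCost r S ν a b c ∂(Measure.pi fun _ : 𝓜 × 𝓚 => μ)
      ≤ a * ENNReal.ofReal (∫ q, r q.1 q.2 *
          Real.log (smoothedOutput r w (Fintype.card (𝓜 × 𝓚)) q.1 q.2) ∂(μ.prod ν))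
        + b * (∫⁻ q in Sᶜ, ENNReal.ofReal (r q.1 q.2) ∂(μ.prod ν)
          + Fintype.card 𝓜 * ∫⁻ q in S, ENNReal.ofReal (w q.2) ∂(μ.prod ν)) := by
  have hkl : Measurable fun q : (𝓜 × 𝓚 → X) × Y =>
      ENNReal.ofReal (InformationTheory.klFun (codebookDensity r q.1 q.2)) :=
    (InformationTheory.measurable_klFun.comp h.measurable_codebookDensity).ennreal_ofReal
  have herr := fun j : 𝓜 × 𝓚 => h.measurable_unionBoundError hS j
  have hsum := Finset.measurable_fun_sum Finset.univ
    fun (j : 𝓜 × 𝓚) _ => (herr j).lintegral_prod_right' (ν := ν)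
  simp only [codebookCost]
  rw [lintegral_add_left (hkl.lintegral_prod_right'.const_mul _),
    lintegral_const_mul _ hkl.lintegral_prod_right', lintegral_const_mul _ (hsum.const_mul _),
    lintegral_const_mul _ hsum, lintegral_finsetSum _ fun j _ => (herr j).lintegral_prod_right',
    ← lintegral_prod _ hkl.aemeasurable]
  simp_rw [← lintegral_prod _ (herr _).aemeasurable]
  gcongr
  · exact h.lintegral_klFun_codebookDensity_le
  · refine (mul_le_mul_right (Finset.sum_le_sum fun j _ =>
      h.lintegral_unionBoundError_le hS j) _).trans_eq ?_
    rw [Finset.sum_const, Finset.card_univ, nsmul_eq_mul, ← mul_assoc,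
      ENNReal.inv_mul_cancel (by simp) (ENNReal.natCast_ne_top _), one_mul]

/- The weights `a` and `b` let a single codebook be good for the divergence and for the error. -/
theorem exists_codebook [IsProbabilityMeasure ν] [Nonempty 𝓜] (h : IsChannelDensity μ ν r w)
    (hS : MeasurableSet S) {good : X → Prop} (hgood : ∀ᵐ x ∂μ, good x) {D : ℝ}
    (hD : ∫ q, r q.1 q.2 * Real.log (w q.2) ∂(μ.prod ν) < D) (a b : ℝ≥0∞) :
    ∃ (K : ℕ) (c : 𝓜 × Fin K → X), 0 < K ∧ (∀ j, good (c j)) ∧ codebookCost r S ν a b c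
      ≤ a * ENNReal.ofReal D + b * (∫⁻ q in Sᶜ, ENNReal.ofReal (r q.1 q.2) ∂(μ.prod ν)
        + Fintype.card 𝓜 * ∫⁻ q in S, ENNReal.ofReal (w q.2) ∂(μ.prod ν)) := by
  obtain ⟨N, hN⟩ := eventually_atTop.1
    (h.tendsto_integral_mul_log_smoothedOutput.eventually_lt_const hD)
  have hcard : N ≤ Fintype.card (𝓜 × Fin (N + 1)) := by
    rw [Fintype.card_prod, Fintype.card_fin]
    nlinarith [Fintype.card_pos (α := 𝓜)]
  have hgood_all : ∀ᵐ c ∂(Measure.pi fun _ : 𝓜 × Fin (N + 1) => μ), ∀ j, good (c j) :=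
    ae_all_iff.2 fun j =>
      (measurePreserving_eval (fun _ : 𝓜 × Fin (N + 1) => μ) j).quasiMeasurePreserving.ae hgood
  obtain ⟨c, hc, hcost⟩ := exists_notMem_null_le_lintegral
    (h.measurable_codebookCost hS a b).aemeasurable (ae_iff.1 hgood_all)
  refine ⟨N + 1, c, N.succ_pos, not_not.1 hc,
    (hcost.trans (h.lintegral_codebookCost_le hS a b)).trans ?_⟩
  gcongr
  exact (hN _ hcard).le

end IsChannelDensity

end TypicalSetDecoder

section Density

/-- A measurable probability density `p ≤ b` for which `p ^ ζ` with some exponent `ζ < 1` is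
integrable. This makes the moment generating function of `-ln p` finite on `(-∞, 1 - ζ]`. -/
structure RegularDensity (p : ℝ → ℝ) (b ζ : ℝ) : Prop where
  measurable : Measurable p
  nonneg : ∀ z, 0 ≤ p z
  one_le : 1 ≤ b
  le_bound : ∀ z, p z ≤ b
  integrable : Integrable p volume
  integral_eq_one : ∫ z, p z = 1
  exponent_mem : ζ ∈ Set.Ioo (0 : ℝ) 1
  integrable_rpow : Integrable (fun z => p z ^ ζ) volume

/-- The information content `-ln p` of a density. -/
noncomputable def surprisal (p : ℝ → ℝ) (z : ℝ) : ℝ := -Real.log (p z)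

/-- The information content of a vector with i.i.d. coordinates of density `p`. -/
noncomputable def totalSurprisal (p : ℝ → ℝ) {n : ℕ} (y : Fin n → ℝ) : ℝ :=
  ∑ i, surprisal p (y i)

/-- The differential entropy `-∫ p ln p` of a density. -/
noncomputable abbrev diffEntropy (p : ℝ → ℝ) : ℝ := ∫ z, surprisal p z ∂(lawOf p)

/-- The cumulant generating function `γ ↦ ln ∫ p ^ (1 - γ)` of the information content. -/
noncomputable abbrev surprisalCgf (p : ℝ → ℝ) : ℝ → ℝ := cgf (surprisal p) (lawOf p)

/-- The law with the tilted density, written as an exponential tilt of the noise law. -/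
noncomputable abbrev tiltedLaw (p : ℝ → ℝ) (γ : ℝ) : Measure ℝ :=
  (lawOf p).tilted fun z => γ * surprisal p z

/-- The law of a vector with i.i.d. coordinates of law `tiltedLaw p γ`. -/
noncomputable abbrev tiltedNoiseLaw (p : ℝ → ℝ) (γ : ℝ) (n : ℕ) : Measure (Fin n → ℝ) :=
  Measure.pi fun _ => tiltedLaw p γ

/-- The density of `tiltedNoiseLaw p γ n` relative to the law of the noise. -/
noncomputable def tiltedNoiseDensity (p : ℝ → ℝ) (γ : ℝ) {n : ℕ} (y : Fin n → ℝ) : ℝ :=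
  Real.exp (γ * totalSurprisal p y - n * surprisalCgf p γ)

/-- The density of the noise vector shifted by `x`, relative to the unshifted one. -/
noncomputable def shiftDensity (p : ℝ → ℝ) {n : ℕ} (x y : Fin n → ℝ) : ℝ :=
  (∏ i, p (y i - x i)) / ∏ i, p (y i)

variable {p : ℝ → ℝ} {b ζ : ℝ} {n : ℕ}

theorem tiltedNoiseDensity_pos (γ : ℝ) (y : Fin n → ℝ) : 0 < tiltedNoiseDensity p γ y :=
  Real.exp_pos _

theorem log_tiltedNoiseDensity (γ : ℝ) (y : Fin n → ℝ) :
    Real.log (tiltedNoiseDensity p γ y) = γ * totalSurprisal p y - n * surprisalCgf p γ :=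
  Real.log_exp _

theorem shiftDensity_add_pos {x z : Fin n → ℝ} (hz : ∀ i, 0 < p (z i))
    (hx : ∀ i, 0 < p (x i + z i)) : 0 < shiftDensity p x (x + z) := by
  simp only [shiftDensity, Pi.add_apply, add_sub_cancel_left]
  exact div_pos (Finset.prod_pos fun i _ => hz i) (Finset.prod_pos fun i _ => hx i)

theorem log_shiftDensity_add {x z : Fin n → ℝ} (hz : ∀ i, 0 < p (z i))
    (hx : ∀ i, 0 < p (x i + z i)) :
    Real.log (shiftDensity p x (x + z)) = totalSurprisal p (x + z) - totalSurprisal p z := by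
  simp only [shiftDensity, Pi.add_apply, add_sub_cancel_left]
  rw [Real.log_div (Finset.prod_pos fun i _ => hz i).ne' (Finset.prod_pos fun i _ => hx i).ne',
    Real.log_prod fun i _ => (hz i).ne', Real.log_prod fun i _ => (hx i).ne']
  simp only [totalSurprisal, surprisal, Finset.sum_neg_distrib, Pi.add_apply]
  ring

namespace RegularDensity

theorem measurable_surprisal (h : RegularDensity p b ζ) : Measurable (surprisal p) :=
  h.measurable.log.neg

theorem measurable_totalSurprisal (h : RegularDensity p b ζ) (n : ℕ) :
    Measurable fun y : Fin n → ℝ => totalSurprisal p y :=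
  Finset.measurable_fun_sum _ fun i _ => h.measurable_surprisal.comp (measurable_pi_apply i)

theorem measurable_tiltedNoiseDensity (h : RegularDensity p b ζ) (γ : ℝ) (n : ℕ) :
    Measurable fun y : Fin n → ℝ => tiltedNoiseDensity p γ y :=
  (((h.measurable_totalSurprisal n).const_mul γ).sub_const _).exp

theorem measurable_prod (h : RegularDensity p b ζ) (n : ℕ) :
    Measurable fun y : Fin n → ℝ => ∏ i, p (y i) :=
  Finset.measurable_fun_prod _ fun i _ => h.measurable.comp (measurable_pi_apply i)

theorem measurable_shiftDensity (h : RegularDensity p b ζ) (n : ℕ) :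
    Measurable fun q : (Fin n → ℝ) × (Fin n → ℝ) => shiftDensity p q.1 q.2 :=
  ((h.measurable_prod n).comp (measurable_snd.sub measurable_fst)).div
    ((h.measurable_prod n).comp measurable_snd)

theorem measurable_shiftDensity_right (h : RegularDensity p b ζ) (x : Fin n → ℝ) :
    Measurable fun y => shiftDensity p x y :=
  (h.measurable_shiftDensity n).comp (measurable_const.prodMk measurable_id)

theorem measurableSet_forall_pos (h : RegularDensity p b ζ) (n : ℕ) :
    MeasurableSet {y : Fin n → ℝ | ∀ i, 0 < p (y i)} := by
  rw [Set.ofPred_forall]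
  exact MeasurableSet.iInter fun i =>
    measurableSet_lt measurable_const (h.measurable.comp (measurable_pi_apply i))

theorem prod_nonneg (h : RegularDensity p b ζ) (y : Fin n → ℝ) : 0 ≤ ∏ i, p (y i) :=
  Finset.prod_nonneg fun _ _ => h.nonneg _

theorem shiftDensity_nonneg (h : RegularDensity p b ζ) (x y : Fin n → ℝ) :
    0 ≤ shiftDensity p x y :=
  div_nonneg (h.prod_nonneg fun i => y i - x i) (h.prod_nonneg y)

theorem neg_log_le_surprisal (h : RegularDensity p b ζ) (z : ℝ) : -Real.log b ≤ surprisal p z := by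
  rw [surprisal, neg_le_neg_iff]
  rcases (h.nonneg z).eq_or_lt with h0 | h0
  · rw [← h0, Real.log_zero]
    exact Real.log_nonneg h.one_le
  · exact Real.log_le_log h0 (h.le_bound z)

theorem neg_mul_log_le_totalSurprisal (h : RegularDensity p b ζ) (y : Fin n → ℝ) :
    -(n * Real.log b) ≤ totalSurprisal p y :=
  calc -(n * Real.log b) = ∑ _i : Fin n, -Real.log b := by simp
    _ ≤ totalSurprisal p y := Finset.sum_le_sum fun _ _ => h.neg_log_le_surprisal _

theorem isProbabilityMeasure (h : RegularDensity p b ζ) : IsProbabilityMeasure (lawOf p) := by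
  constructor
  rw [lawOf, withDensity_apply _ MeasurableSet.univ, Measure.restrict_univ,
    ← ofReal_integral_eq_lintegral_ofReal h.integrable (ae_of_all _ h.nonneg), h.integral_eq_one,
    ENNReal.ofReal_one]

theorem isProbabilityMeasure_noiseLaw (h : RegularDensity p b ζ) (n : ℕ) :
    IsProbabilityMeasure (noiseLaw p n) := by
  have := h.isProbabilityMeasure
  unfold noiseLaw
  infer_instance

theorem isProbabilityMeasure_map_const_add (h : RegularDensity p b ζ) (x : Fin n → ℝ) :
    IsProbabilityMeasure ((noiseLaw p n).map fun z => x + z) := by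
  have := h.isProbabilityMeasure_noiseLaw n
  exact Measure.isProbabilityMeasure_map (measurable_const_add x).aemeasurable

theorem ae_pos (h : RegularDensity p b ζ) : ∀ᵐ z ∂(lawOf p), 0 < p z := by
  rw [lawOf, ae_withDensity_iff h.measurable.ennreal_ofReal]
  exact ae_of_all _ fun z hz => by simpa using hz

theorem ae_pos_noiseLaw (h : RegularDensity p b ζ) (n : ℕ) :
    ∀ᵐ z ∂(noiseLaw p n), ∀ i, 0 < p (z i) := by
  have := h.isProbabilityMeasure
  rw [ae_all_iff]
  exact fun i => (measurePreserving_eval (fun _ : Fin n => lawOf p) i).quasiMeasurePreserving.ae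
    h.ae_pos

theorem mul_exp_surprisal (h : RegularDensity p b ζ) {γ : ℝ} (hγ : γ < 1) (z : ℝ) :
    p z * Real.exp (γ * surprisal p z) = p z ^ (1 - γ) := by
  rcases (h.nonneg z).eq_or_lt with h0 | h0
  · rw [← h0, zero_mul, Real.zero_rpow (by linarith)]
  · rw [Real.rpow_sub h0, Real.rpow_one, Real.rpow_def_of_pos h0, surprisal, div_eq_mul_inv,
      ← Real.exp_neg]
    ring_nf

theorem integrable_exp_surprisal (h : RegularDensity p b ζ) {t : ℝ} (ht : t ≤ 1 - ζ) :
    Integrable (fun z => Real.exp (t * surprisal p z)) (lawOf p) := by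
  have hζ := h.exponent_mem
  have hmax : Integrable (fun z => Real.exp ((1 - ζ) * surprisal p z)) (lawOf p) := by
    rw [lawOf, integrable_withDensity_ofReal_iff h.measurable h.nonneg]
    simp_rw [h.mul_exp_surprisal (show 1 - ζ < 1 by linarith [hζ.1]), sub_sub_cancel]
    exact h.integrable_rpow
  refine (hmax.const_mul (Real.exp ((1 - ζ - t) * Real.log b))).mono'
    (h.measurable_surprisal.const_mul t).exp.aestronglyMeasurable (ae_of_all _ fun z => ?_)
  rw [Real.norm_of_nonneg (Real.exp_pos _).le, ← Real.exp_add, Real.exp_le_exp]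
  have hlower := mul_le_mul_of_nonneg_left (h.neg_log_le_surprisal z) (sub_nonneg.2 ht)
  linarith

theorem mem_interior_integrableExpSet (h : RegularDensity p b ζ) {t : ℝ} (ht : t < 1 - ζ) :
    t ∈ interior (integrableExpSet (surprisal p) (lawOf p)) :=
  mem_interior.2 ⟨Set.Iio (1 - ζ), fun _ hs => h.integrable_exp_surprisal (le_of_lt hs),
    isOpen_Iio, ht⟩

theorem zero_mem_interior_integrableExpSet (h : RegularDensity p b ζ) :
    0 ∈ interior (integrableExpSet (surprisal p) (lawOf p)) :=
  h.mem_interior_integrableExpSet (by linarith [h.exponent_mem.2])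

theorem memLp_surprisal (h : RegularDensity p b ζ) : MemLp (surprisal p) 2 (lawOf p) := by
  exact_mod_cast memLp_of_mem_interior_integrableExpSet h.zero_mem_interior_integrableExpSet 2

theorem integrable_surprisal (h : RegularDensity p b ζ) : Integrable (surprisal p) (lawOf p) :=
  integrable_of_mem_interior_integrableExpSet h.zero_mem_interior_integrableExpSet

theorem integrable_totalSurprisal (h : RegularDensity p b ζ) (n : ℕ) :
    Integrable (fun y => totalSurprisal p y) (noiseLaw p n) := by
  have := h.isProbabilityMeasure
  exact integrable_sum_comp_eval h.integrable_surprisal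

theorem integral_totalSurprisal (h : RegularDensity p b ζ) (n : ℕ) :
    ∫ y, totalSurprisal p y ∂(noiseLaw p n) = n * diffEntropy p := by
  have := h.isProbabilityMeasure
  simp_rw [totalSurprisal]
  rw [noiseLaw, integral_sum_comp_eval h.integrable_surprisal, Fintype.card_fin]

theorem integral_exp_surprisal (h : RegularDensity p b ζ) {t : ℝ} (ht : t ≤ 1 - ζ) :
    ∫ z, Real.exp (t * surprisal p z) ∂(lawOf p) = Real.exp (surprisalCgf p t) := by
  have := h.isProbabilityMeasure
  exact (exp_cgf (h.integrable_exp_surprisal ht)).symm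

theorem integrable_exp_totalSurprisal (h : RegularDensity p b ζ) {t : ℝ} (ht : t ≤ 1 - ζ) (n : ℕ) :
    Integrable (fun y => Real.exp (t * totalSurprisal p y)) (noiseLaw p n) := by
  have := h.isProbabilityMeasure
  simp_rw [totalSurprisal, Finset.mul_sum, Real.exp_sum]
  exact Integrable.fintype_prod fun _ => h.integrable_exp_surprisal ht

theorem integral_exp_totalSurprisal (h : RegularDensity p b ζ) {t : ℝ} (ht : t ≤ 1 - ζ) (n : ℕ) :
    ∫ y, Real.exp (t * totalSurprisal p y) ∂(noiseLaw p n)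
      = Real.exp (n * surprisalCgf p t) := by
  have := h.isProbabilityMeasure
  simp_rw [totalSurprisal, Finset.mul_sum, Real.exp_sum]
  rw [noiseLaw, integral_fintype_prod_eq_pow (fun z => Real.exp (t * surprisal p z)),
    h.integral_exp_surprisal ht, Fintype.card_fin, ← Real.exp_nat_mul]

theorem isProbabilityMeasure_tiltedLaw (h : RegularDensity p b ζ) {γ : ℝ} (hγ : γ ≤ 1 - ζ) :
    IsProbabilityMeasure (tiltedLaw p γ) := by
  have := h.isProbabilityMeasure
  exact isProbabilityMeasure_tilted (h.integrable_exp_surprisal hγ)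

theorem tiltedLaw_eq_withDensity (h : RegularDensity p b ζ) {γ : ℝ} (hγ : γ ≤ 1 - ζ) :
    tiltedLaw p γ = (lawOf p).withDensity fun z =>
      ENNReal.ofReal (Real.exp (γ * surprisal p z - surprisalCgf p γ)) := by
  rw [tiltedLaw, Measure.tilted, h.integral_exp_surprisal hγ]
  simp_rw [← Real.exp_sub]

theorem lawOf_tilted (h : RegularDensity p b ζ) {γ : ℝ} (hγ : γ ≤ 1 - ζ) :
    lawOf (tilted p γ) = tiltedLaw p γ := by
  have hγ1 : γ < 1 := by linarith [h.exponent_mem.1]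
  have hnorm : ∫ t, p t ^ (1 - γ) = Real.exp (surprisalCgf p γ) := by
    rw [← h.integral_exp_surprisal hγ, lawOf, integral_withDensity_ofReal h.measurable h.nonneg]
    simp_rw [h.mul_exp_surprisal hγ1]
  rw [h.tiltedLaw_eq_withDensity hγ]
  generalize surprisalCgf p γ = c at hnorm ⊢
  have hm : Measurable fun z => Real.exp (γ * surprisal p z - c) :=
    ((h.measurable_surprisal.const_mul γ).sub_const _).exp
  rw [lawOf, lawOf, ← withDensity_mul _ h.measurable.ennreal_ofReal hm.ennreal_ofReal]
  congr 1
  funext z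
  rw [Pi.mul_apply, ← ENNReal.ofReal_mul (h.nonneg z), tilted, hnorm, ← h.mul_exp_surprisal hγ1,
    Real.exp_sub]
  congr 1
  ring

theorem tiltedNoiseLaw_eq_withDensity (h : RegularDensity p b ζ) {γ : ℝ} (hγ : γ ≤ 1 - ζ) (n : ℕ) :
    tiltedNoiseLaw p γ n
      = (noiseLaw p n).withDensity fun y => ENNReal.ofReal (tiltedNoiseDensity p γ y) := by
  have := h.isProbabilityMeasure
  have hint : Integrable (fun z => Real.exp (γ * surprisal p z - surprisalCgf p γ))
      (lawOf p) := by
    simp_rw [Real.exp_sub]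
    exact (h.integrable_exp_surprisal hγ).div_const _
  rw [tiltedNoiseLaw, h.tiltedLaw_eq_withDensity hγ,
    pi_withDensity_ofReal (fun _ : Fin n => lawOf p) (fun _ => hint)
      fun _ _ => (Real.exp_pos _).le, noiseLaw]
  simp_rw [← Real.exp_sum, Finset.sum_sub_distrib, tiltedNoiseDensity, totalSurprisal,
    Finset.mul_sum]
  simp

theorem tilted_totalSurprisal_noiseLaw (h : RegularDensity p b ζ) {γ : ℝ} (hγ : γ ≤ 1 - ζ)
    (n : ℕ) : (noiseLaw p n).tilted (fun y => γ * totalSurprisal p y) = tiltedNoiseLaw p γ n := by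
  rw [h.tiltedNoiseLaw_eq_withDensity hγ, Measure.tilted, h.integral_exp_totalSurprisal hγ]
  simp_rw [← Real.exp_sub, tiltedNoiseDensity]

theorem tiltedNoiseLaw_absolutelyContinuous (h : RegularDensity p b ζ) {γ : ℝ} (hγ : γ ≤ 1 - ζ)
    (n : ℕ) : tiltedNoiseLaw p γ n ≪ noiseLaw p n := by
  rw [h.tiltedNoiseLaw_eq_withDensity hγ]
  exact withDensity_absolutelyContinuous _ _

theorem memLp_surprisal_tiltedLaw (h : RegularDensity p b ζ) {γ : ℝ} (hγ : γ < 1 - ζ) :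
    MemLp (surprisal p) 2 (tiltedLaw p γ) := by
  exact_mod_cast memLp_tilted_mul (h.mem_interior_integrableExpSet hγ) 2

theorem integral_surprisal_tiltedLaw (h : RegularDensity p b ζ) {γ : ℝ} (hγ : γ < 1 - ζ) :
    ∫ z, surprisal p z ∂(tiltedLaw p γ) = deriv (surprisalCgf p) γ :=
  integral_tilted_mul_self (h.mem_interior_integrableExpSet hγ)

theorem integral_sq_surprisal_tiltedLaw (h : RegularDensity p b ζ) {γ : ℝ} (hγ : γ < 1 - ζ) :
    ∫ z, surprisal p z ^ 2 ∂(tiltedLaw p γ)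
      = iteratedDeriv 2 (surprisalCgf p) γ + deriv (surprisalCgf p) γ ^ 2 := by
  have := h.isProbabilityMeasure_tiltedLaw hγ.le
  have hvar := variance_eq_sub (h.memLp_surprisal_tiltedLaw hγ)
  rw [variance_tilted_mul (h.mem_interior_integrableExpSet hγ),
    h.integral_surprisal_tiltedLaw hγ] at hvar
  exact (eq_add_of_sub_eq hvar.symm)

theorem integrable_exp_surprisal_tiltedLaw (h : RegularDensity p b ζ) {γ s : ℝ}
    (hγ : γ ≤ 1 - ζ) (hs : s + γ ≤ 1 - ζ) :
    Integrable (fun z => Real.exp (s * surprisal p z)) (tiltedLaw p γ) := by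
  rw [integrable_tilted_iff (h.integrable_exp_surprisal hγ)]
  simp_rw [smul_eq_mul, ← Real.exp_add, ← add_mul, add_comm γ s]
  exact h.integrable_exp_surprisal hs

theorem integral_exp_surprisal_tiltedLaw (h : RegularDensity p b ζ) {γ s : ℝ}
    (hγ : γ ≤ 1 - ζ) (hs : s + γ ≤ 1 - ζ) :
    ∫ z, Real.exp (s * surprisal p z) ∂(tiltedLaw p γ)
      = Real.exp (surprisalCgf p (s + γ) - surprisalCgf p γ) := by
  rw [integral_exp_tilted, h.integral_exp_surprisal hγ, Real.exp_sub,
    ← h.integral_exp_surprisal hs]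
  simp_rw [Pi.add_apply, ← add_mul, add_comm γ s]

theorem integrable_totalSurprisal_tiltedNoiseLaw (h : RegularDensity p b ζ) {γ : ℝ}
    (hγ : γ < 1 - ζ) (n : ℕ) :
    Integrable (fun y => totalSurprisal p y) (tiltedNoiseLaw p γ n) := by
  have := h.isProbabilityMeasure_tiltedLaw hγ.le
  exact integrable_sum_comp_eval ((h.memLp_surprisal_tiltedLaw hγ).integrable one_le_two)

theorem integral_totalSurprisal_tiltedNoiseLaw (h : RegularDensity p b ζ) {γ : ℝ}
    (hγ : γ < 1 - ζ) (n : ℕ) :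
    ∫ y, totalSurprisal p y ∂(tiltedNoiseLaw p γ n) = n * deriv (surprisalCgf p) γ := by
  have := h.isProbabilityMeasure_tiltedLaw hγ.le
  simp_rw [totalSurprisal]
  rw [integral_sum_comp_eval ((h.memLp_surprisal_tiltedLaw hγ).integrable one_le_two),
    h.integral_surprisal_tiltedLaw hγ, Fintype.card_fin]

theorem noiseLaw_eq_withDensity (h : RegularDensity p b ζ) (n : ℕ) :
    noiseLaw p n = volume.withDensity fun y => ENNReal.ofReal (∏ i, p (y i)) := by
  rw [noiseLaw, volume_pi]
  exact pi_withDensity_ofReal (fun _ : Fin n => (volume : Measure ℝ)) (fun _ => h.integrable)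
    fun _ => h.nonneg

theorem map_const_add_noiseLaw (h : RegularDensity p b ζ) (x : Fin n → ℝ) :
    (noiseLaw p n).map (fun z => x + z)
      = volume.withDensity fun y => ENNReal.ofReal (∏ i, p (y i - x i)) := by
  have hm : Measurable fun y : Fin n → ℝ => ENNReal.ofReal (∏ i, p (y i - x i)) :=
    ((h.measurable_prod n).comp (measurable_id.sub_const x)).ennreal_ofReal
  have hmp := measurePreserving_withDensity_comp (measurePreserving_add_left volume x) hm
  simp only [Pi.add_apply, add_sub_cancel_left, ← h.noiseLaw_eq_withDensity] at hmp
  exact hmp.map_eq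

-- Without the positivity assumption, `shiftDensity` may vanish (division by zero) on a set that
-- the shifted law charges.
theorem map_const_add_noiseLaw_eq_withDensity (h : RegularDensity p b ζ) {x : Fin n → ℝ}
    (hx : ∀ᵐ z ∂(noiseLaw p n), ∀ i, 0 < p (x i + z i)) :
    (noiseLaw p n).map (fun z => x + z)
      = (noiseLaw p n).withDensity fun y => ENNReal.ofReal (shiftDensity p x y) := by
  have hx' : ∀ᵐ y ∂((noiseLaw p n).map fun z => x + z), ∀ i, 0 < p (y i) :=
    (ae_map_iff (measurable_const_add x).aemeasurable (h.measurableSet_forall_pos n)).2 hx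
  have hnum : Measurable fun y : Fin n → ℝ => ∏ i, p (y i - x i) :=
    (h.measurable_prod n).comp (measurable_id.sub_const x)
  rw [h.map_const_add_noiseLaw, ae_withDensity_iff hnum.ennreal_ofReal] at hx'
  rw [h.map_const_add_noiseLaw, h.noiseLaw_eq_withDensity, ← withDensity_mul _
    (h.measurable_prod n).ennreal_ofReal (h.measurable_shiftDensity_right x).ennreal_ofReal]
  refine withDensity_congr_ae ?_
  filter_upwards [hx'] with y hy
  rw [Pi.mul_apply, ← ENNReal.ofReal_mul (h.prod_nonneg y), shiftDensity]
  rcases (h.prod_nonneg fun i => y i - x i).eq_or_lt with hzero | hpos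
  · simp [← hzero]
  · have hy_pos := hy (ENNReal.ofReal_pos.2 hpos).ne'
    rw [mul_div_cancel₀ _ (Finset.prod_pos fun i _ => hy_pos i).ne']

theorem map_const_add_absolutelyContinuous (h : RegularDensity p b ζ) {x : Fin n → ℝ}
    (hx : ∀ᵐ z ∂(noiseLaw p n), ∀ i, 0 < p (x i + z i)) :
    (noiseLaw p n).map (fun z => x + z) ≪ noiseLaw p n := by
  rw [h.map_const_add_noiseLaw_eq_withDensity hx]
  exact withDensity_absolutelyContinuous _ _

end RegularDensity

end Density

section Converse

namespace RegularDensity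

variable {p : ℝ → ℝ} {b ζ : ℝ} {n : ℕ} {x : Fin n → ℝ}

theorem llr_map_const_add (h : RegularDensity p b ζ)
    (hx : ∀ᵐ z ∂(noiseLaw p n), ∀ i, 0 < p (x i + z i)) :
    (fun z => llr ((noiseLaw p n).map fun z => x + z) (noiseLaw p n) (x + z))
      =ᵐ[noiseLaw p n] fun z => totalSurprisal p (x + z) - totalSurprisal p z := by
  have := h.isProbabilityMeasure_noiseLaw n
  have hrn := Measure.rnDeriv_withDensity (noiseLaw p n)
    (h.measurable_shiftDensity_right x).ennreal_ofReal
  rw [← h.map_const_add_noiseLaw_eq_withDensity hx] at hrn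
  have hrn' := ae_of_ae_map (measurable_const_add x).aemeasurable
    ((h.map_const_add_absolutelyContinuous hx).ae_eq hrn)
  filter_upwards [hrn', hx, h.ae_pos_noiseLaw n] with z hz hxz hpz
  rw [llr, hz, ENNReal.toReal_ofReal (h.shiftDensity_nonneg x _), log_shiftDensity_add hpz hxz]

theorem integrable_llr_map_const_add (h : RegularDensity p b ζ)
    (hx : ∀ᵐ z ∂(noiseLaw p n), ∀ i, 0 < p (x i + z i))
    (hint : Integrable (fun z => totalSurprisal p (x + z)) (noiseLaw p n)) :
    Integrable (llr ((noiseLaw p n).map fun z => x + z) (noiseLaw p n))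
      ((noiseLaw p n).map fun z => x + z) :=
  (integrable_map_measure (measurable_llr _ _).aestronglyMeasurable
    (measurable_const_add x).aemeasurable).2
    ((hint.sub (h.integrable_totalSurprisal n)).congr (h.llr_map_const_add hx).symm)

theorem integral_llr_map_const_add (h : RegularDensity p b ζ)
    (hx : ∀ᵐ z ∂(noiseLaw p n), ∀ i, 0 < p (x i + z i))
    (hint : Integrable (fun z => totalSurprisal p (x + z)) (noiseLaw p n)) :
    ∫ y, llr ((noiseLaw p n).map fun z => x + z) (noiseLaw p n) y
        ∂((noiseLaw p n).map fun z => x + z)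
      = ∫ z, totalSurprisal p (x + z) ∂(noiseLaw p n) - n * diffEntropy p := by
  rw [integral_map (measurable_const_add x).aemeasurable
    (measurable_llr _ _).aestronglyMeasurable, integral_congr_ae (h.llr_map_const_add hx),
    integral_sub hint (h.integrable_totalSurprisal n), h.integral_totalSurprisal]

theorem log_mul_measureReal_const_add_le (h : RegularDensity p b ζ)
    (hx : ∀ᵐ z ∂(noiseLaw p n), ∀ i, 0 < p (x i + z i))
    (hint : Integrable (fun z => totalSurprisal p (x + z)) (noiseLaw p n)) {γ : ℝ}
    (hγ : γ ≤ 1 - ζ) {D : Set (Fin n → ℝ)} (hD : MeasurableSet D) {M : ℝ} (hM : 0 < M) :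
    Real.log M * (noiseLaw p n).real {z | x + z ∈ D} ≤
      (1 - γ) * ∫ z, totalSurprisal p (x + z) ∂(noiseLaw p n) - n * diffEntropy p
        + n * surprisalCgf p γ + M * (tiltedNoiseLaw p γ n).real D := by
  have hadd := measurable_const_add x
  have := h.isProbabilityMeasure_noiseLaw n
  have := h.isProbabilityMeasure_map_const_add x
  have := h.isProbabilityMeasure_tiltedLaw hγ
  have hac := h.map_const_add_absolutelyContinuous hx
  have hexp := h.integrable_exp_totalSurprisal hγ n
  have hllr := h.integrable_llr_map_const_add hx hint
  have hT : Integrable (fun y => γ * totalSurprisal p y) ((noiseLaw p n).map fun z => x + z) :=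
    ((integrable_map_measure (h.measurable_totalSurprisal n).aestronglyMeasurable
      hadd.aemeasurable).2 hint).const_mul γ
  have hllr' := integrable_llr_tilted_right hac hT hllr hexp
  have hval := integral_llr_tilted_right hac hT hexp hllr
  have hac' := hac.trans (absolutelyContinuous_tilted hexp)
  rw [h.tilted_totalSurprisal_noiseLaw hγ] at hllr' hval hac'
  have hbound := log_mul_measureReal_le hac' hllr' hD hM
  rw [map_measureReal_apply hadd hD, hval, h.integral_llr_map_const_add hx hint,
    h.integral_exp_totalSurprisal hγ, Real.log_exp, integral_const_mul,
    integral_map hadd.aemeasurable (h.measurable_totalSurprisal n).aestronglyMeasurable] at hbound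
  refine hbound.trans (le_of_eq ?_)
  ring

end RegularDensity

variable {p : ℝ → ℝ} {b ζ : ℝ} {n M K : ℕ}

namespace Code

theorem isProbabilityMeasure_outputLaw (C : Code n M K) [IsProbabilityMeasure (noiseLaw p n)]
    (hM : 0 < M) (hK : 0 < K) : IsProbabilityMeasure (C.outputLaw p) := by
  have := fun m k => Measure.isProbabilityMeasure_map (μ := noiseLaw p n)
    (measurable_const_add (C.encode m k)).aemeasurable
  constructor
  simp only [outputLaw, Measure.smul_apply, Measure.finsetSum_apply, measure_univ, smul_eq_mul,
    Finset.sum_const, Finset.card_univ, Fintype.card_fin, nsmul_eq_mul, mul_one]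
  rw [mul_comm (M : ℝ≥0∞)]
  exact ENNReal.inv_mul_cancel (by simp [hM.ne', hK.ne']) (by finiteness)

theorem map_const_add_absolutelyContinuous_outputLaw (C : Code n M K) (m : Fin M) (k : Fin K) :
    (noiseLaw p n).map (fun z => C.encode m k + z) ≪ C.outputLaw p := by
  refine Measure.AbsolutelyContinuous.mk fun s _ hs => ?_
  rw [outputLaw, Measure.smul_apply, smul_eq_mul, mul_eq_zero,
    or_iff_right (ENNReal.inv_ne_zero.2 (by finiteness)), Measure.finsetSum_apply,
    Finset.sum_eq_zero_iff] at hs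
  have hm := hs m (Finset.mem_univ m)
  rw [Measure.finsetSum_apply, Finset.sum_eq_zero_iff] at hm
  exact hm k (Finset.mem_univ k)

theorem integrable_outputLaw_iff (C : Code n M K) (hM : 0 < M) (hK : 0 < K)
    {f : (Fin n → ℝ) → ℝ} (hf : Measurable f) :
    Integrable f (C.outputLaw p)
      ↔ ∀ m k, Integrable (fun z => f (C.encode m k + z)) (noiseLaw p n) := by
  rw [outputLaw, integrable_smul_measure (ENNReal.inv_ne_zero.2 (by finiteness))
    (ENNReal.inv_ne_top.2 (by simp [hM.ne', hK.ne']))]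
  simp only [integrable_finsetSum_measure, Finset.mem_univ, true_imp_iff]
  refine forall₂_congr fun m k => ?_
  exact integrable_map_measure hf.aestronglyMeasurable
    (measurable_const_add (C.encode m k)).aemeasurable

theorem integral_outputLaw (C : Code n M K) {f : (Fin n → ℝ) → ℝ} (hf : Measurable f)
    (hint : ∀ m k, Integrable (fun z => f (C.encode m k + z)) (noiseLaw p n)) :
    ∫ y, f y ∂(C.outputLaw p)
      = ((K : ℝ) * M)⁻¹ * ∑ m, ∑ k, ∫ z, f (C.encode m k + z) ∂(noiseLaw p n) := by
  have hadd := fun m k => (measurable_const_add (C.encode m k)).aemeasurable (μ := noiseLaw p n)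
  have hmap : ∀ m k, Integrable f ((noiseLaw p n).map fun z => C.encode m k + z) := fun m k =>
    (integrable_map_measure hf.aestronglyMeasurable (hadd m k)).2 (hint m k)
  rw [outputLaw, integral_smul_measure, integral_finsetSum_measure fun m _ =>
    integrable_finsetSum_measure.2 fun k _ => hmap m k]
  simp_rw [integral_finsetSum_measure fun k _ => hmap _ k,
    integral_map (hadd _ _) hf.aestronglyMeasurable]
  simp

theorem sum_measureReal_decode_le (C : Code n M K) (Q : Measure (Fin n → ℝ))
    [IsProbabilityMeasure Q] (k : Fin K) : ∑ m, Q.real {y | C.decode y k = m} ≤ 1 := by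
  rw [← measureReal_biUnion_finset (fun m _ m' _ hne => Set.disjoint_left.2 fun y hm hm' =>
      hne (hm.symm.trans hm')) fun m _ => C.measurableSet_decode k m]
  exact measureReal_le_one

theorem measureReal_decode_eq (C : Code n M K) [IsProbabilityMeasure (noiseLaw p n)] (m : Fin M)
    (k : Fin K) :
    (noiseLaw p n).real {z | C.decode (C.encode m k + z) k = m}
      = 1 - (noiseLaw p n).real {z | C.decode (C.encode m k + z) k ≠ m} := by
  have hmeas : MeasurableSet {z | C.decode (C.encode m k + z) k = m} :=
    measurable_const_add _ (C.measurableSet_decode k m)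
  rw [eq_sub_iff_add_eq]
  exact (measureReal_add_measureReal_compl hmeas).trans probReal_univ

end Code

namespace RegularDensity

theorem ae_pos_encode_add (h : RegularDensity p b ζ) (C : Code n M K)
    (hac : C.outputLaw p ≪ noiseLaw p n) (m : Fin M) (k : Fin K) :
    ∀ᵐ z ∂(noiseLaw p n), ∀ i, 0 < p (C.encode m k i + z i) :=
  ae_of_ae_map (measurable_const_add _).aemeasurable
    (((C.map_const_add_absolutelyContinuous_outputLaw m k).trans hac).ae_le (h.ae_pos_noiseLaw n))

theorem integrable_totalSurprisal_of_klDiv_ne_top (h : RegularDensity p b ζ)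
    {η : Measure (Fin n → ℝ)} [IsFiniteMeasure η]
    (hkl : InformationTheory.klDiv η (noiseLaw p n) ≠ ∞) :
    Integrable (fun y => totalSurprisal p y) η := by
  have := h.isProbabilityMeasure_noiseLaw n
  obtain ⟨hac, hllr⟩ := InformationTheory.klDiv_ne_top_iff.1 hkl
  have hζ : 0 < 1 - ζ := by linarith [h.exponent_mem.2]
  have hscaled := integrable_of_integrable_exp hac hllr (ae_of_all _ fun y =>
    mul_le_mul_of_nonneg_left (h.neg_mul_log_le_totalSurprisal y) hζ.le)
    (h.integrable_exp_totalSurprisal le_rfl n)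
  exact (integrable_const_mul_iff (IsUnit.mk0 _ hζ.ne') _).1 hscaled

theorem mul_integral_totalSurprisal_le (h : RegularDensity p b ζ) {η : Measure (Fin n → ℝ)}
    [IsProbabilityMeasure η] {Δ : ℝ} (hΔ : 0 ≤ Δ)
    (hkl : InformationTheory.klDiv η (noiseLaw p n) ≤ ENNReal.ofReal Δ) {γ : ℝ}
    (hγ : γ ≤ 1 - ζ) : γ * ∫ y, totalSurprisal p y ∂η ≤ Δ + n * surprisalCgf p γ := by
  have := h.isProbabilityMeasure_noiseLaw n
  have hfin := ne_top_of_le_ne_top ENNReal.ofReal_ne_top hkl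
  obtain ⟨hac, hllr⟩ := InformationTheory.klDiv_ne_top_iff.1 hfin
  have hDV := integral_le_integral_llr_add_log hac hllr
    ((h.integrable_totalSurprisal_of_klDiv_ne_top hfin).const_mul γ)
    (h.integrable_exp_totalSurprisal hγ n)
  rw [h.integral_exp_totalSurprisal hγ, Real.log_exp, integral_const_mul,
    ← InformationTheory.toReal_klDiv_of_measure_eq hac (by simp)] at hDV
  linarith [ENNReal.toReal_le_of_le_ofReal hΔ hkl]

theorem log_mul_one_sub_errorProb_le (h : RegularDensity p b ζ) (C : Code n M K) (hM : 0 < M)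
    (hK : 0 < K) (hfin : InformationTheory.klDiv (C.outputLaw p) (noiseLaw p n) ≠ ∞) {γ : ℝ}
    (hγ : γ ≤ 1 - ζ) :
    Real.log M * (1 - C.errorProb p) ≤ (1 - γ) * ∫ y, totalSurprisal p y ∂(C.outputLaw p)
      - n * diffEntropy p + n * surprisalCgf p γ + 1 := by
  have := h.isProbabilityMeasure_noiseLaw n
  have := h.isProbabilityMeasure_tiltedLaw hγ
  have := C.isProbabilityMeasure_outputLaw (p := p) hM hK
  have hT := h.measurable_totalSurprisal n
  have hint := (C.integrable_outputLaw_iff hM hK hT).1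
    (h.integrable_totalSurprisal_of_klDiv_ne_top hfin)
  have hac := (InformationTheory.klDiv_ne_top_iff.1 hfin).1
  have hM' : (0 : ℝ) < M := Nat.cast_pos.2 hM
  have hK' : (0 : ℝ) < K := Nat.cast_pos.2 hK
  have hbound := fun m k => h.log_mul_measureReal_const_add_le (h.ae_pos_encode_add C hac m k)
    (hint m k) hγ (C.measurableSet_decode k m) hM'
  simp only [Set.mem_ofPred_eq, C.measureReal_decode_eq] at hbound
  have hsum := Finset.sum_le_sum fun m (_ : m ∈ Finset.univ) =>
    Finset.sum_le_sum fun k (_ : k ∈ Finset.univ) => hbound m k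
  simp only [Finset.sum_add_distrib, Finset.sum_sub_distrib, ← Finset.mul_sum, mul_sub, mul_one,
    Finset.sum_const, Finset.card_univ, Fintype.card_fin, nsmul_eq_mul] at hsum
  have hdecode : ∑ m, ∑ k, (tiltedNoiseLaw p γ n).real {y | C.decode y k = m} ≤ K := by
    rw [Finset.sum_comm]
    simpa using Finset.sum_le_sum fun k (_ : k ∈ Finset.univ) =>
      C.sum_measureReal_decode_le (tiltedNoiseLaw p γ n) k
  have hdecode' := mul_le_mul_of_nonneg_left hdecode hM'.le
  rw [Code.errorProb, C.integral_outputLaw hT hint]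
  refine le_of_mul_le_mul_left ?_ (mul_pos hK' hM')
  field_simp
  linarith

end RegularDensity

theorem Achievable.one_sub_mul_log_le {Δ ε : ℝ} (hA : Achievable p n Δ ε M)
    (h : RegularDensity p b ζ) (hΔ : 0 ≤ Δ) {γ : ℝ} (hγ0 : 0 < γ) (hγ : γ ≤ 1 - ζ) :
    (1 - ε) * Real.log M
      ≤ n * (surprisalCgf p γ - γ * diffEntropy p) / γ + Δ / γ + 1 := by
  obtain ⟨hM, K, hK, C, hkl, herr⟩ := hA
  have := h.isProbabilityMeasure_noiseLaw n
  have := C.isProbabilityMeasure_outputLaw (p := p) hM hK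
  have hγ1 : 0 ≤ 1 - γ := by linarith [h.exponent_mem.1]
  have : 0 ≤ Real.log M := Real.log_nonneg (by exact_mod_cast hM)
  have hsurprisal := h.mul_integral_totalSurprisal_le hΔ hkl hγ
  rw [← le_div_iff₀' hγ0] at hsurprisal
  calc (1 - ε) * Real.log M ≤ Real.log M * (1 - C.errorProb p) := by
        rw [mul_comm]
        gcongr
    _ ≤ (1 - γ) * ∫ y, totalSurprisal p y ∂(C.outputLaw p) - n * diffEntropy p
          + n * surprisalCgf p γ + 1 :=
        h.log_mul_one_sub_errorProb_le C hM hK (ne_top_of_le_ne_top ENNReal.ofReal_ne_top hkl) hγ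
    _ ≤ (1 - γ) * ((Δ + n * surprisalCgf p γ) / γ) - n * diffEntropy p
          + n * surprisalCgf p γ + 1 := by gcongr
    _ = n * (surprisalCgf p γ - γ * diffEntropy p) / γ + Δ / γ + 1 - Δ := by
        field_simp
        ring
    _ ≤ n * (surprisalCgf p γ - γ * diffEntropy p) / γ + Δ / γ + 1 := sub_le_self _ hΔ

end Converse

section Input

variable {p : ℝ → ℝ} {b ζ γ : ℝ} {μ : Measure ℝ}

/-- `μ` is a law of a channel input whose output has the tilted law. -/
def IsTiltingInput (p : ℝ → ℝ) (γ : ℝ) (μ : Measure ℝ) : Prop :=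
  MeasurePreserving (fun q : ℝ × ℝ => q.1 + q.2) (μ.prod (lawOf p)) (tiltedLaw p γ)

/-- The joint law of an input vector with i.i.d. coordinates of law `μ` and the noise. -/
noncomputable abbrev inputNoiseLaw (p : ℝ → ℝ) (μ : Measure ℝ) (n : ℕ) :
    Measure ((Fin n → ℝ) × (Fin n → ℝ)) :=
  (Measure.pi fun _ => μ).prod (noiseLaw p n)

theorem RegularDensity.exists_isTiltingInput (h : RegularDensity p b ζ) (hγ : γ ≤ 1 - ζ)
    (hout : IsAdditiveOutput p (tilted p γ)) :
    ∃ μ, IsProbabilityMeasure μ ∧ IsTiltingInput p γ μ := by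
  obtain ⟨Ω, _, P, X, Z, _, hX, hZ, hind, hZ_law, hsum⟩ := hout
  have hadd : Measurable fun q : ℝ × ℝ => q.1 + q.2 := measurable_fst.add measurable_snd
  refine ⟨P.map X, Measure.isProbabilityMeasure_map hX.aemeasurable, hadd, ?_⟩
  rw [← h.lawOf_tilted hγ, ← hsum, ← hZ_law,
    ← (indepFun_iff_map_prod_eq_prod_map_map hX.aemeasurable hZ.aemeasurable).1 hind,
    Measure.map_map hadd (hX.prodMk hZ)]
  rfl

theorem RegularDensity.measurePreserving_coords (h : RegularDensity p b ζ) (μ : Measure ℝ)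
    [IsProbabilityMeasure μ] (n : ℕ) :
    MeasurePreserving
      (fun q : Fin n → ℝ × ℝ =>
        ((fun i => (q i).1, fun i => (q i).2) : (Fin n → ℝ) × (Fin n → ℝ)))
      (Measure.pi fun _ => μ.prod (lawOf p)) (inputNoiseLaw p μ n) := by
  have := h.isProbabilityMeasure
  exact measurePreserving_arrowProdEquivProdArrow ℝ ℝ (Fin n) (fun _ => μ) (fun _ => lawOf p)

theorem RegularDensity.measurePreserving_prodMk_add (h : RegularDensity p b ζ) {n : ℕ}
    {π : Measure (Fin n → ℝ)} [SFinite π]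
    (hπ : ∀ᵐ x ∂π, ∀ᵐ z ∂(noiseLaw p n), ∀ i, 0 < p (x i + z i)) :
    MeasurePreserving (fun q : (Fin n → ℝ) × (Fin n → ℝ) => (q.1, q.1 + q.2))
      (π.prod (noiseLaw p n))
      ((π.prod (noiseLaw p n)).withDensity fun q => ENNReal.ofReal (shiftDensity p q.1 q.2)) := by
  have := h.isProbabilityMeasure_noiseLaw n
  have hm : Measurable fun q : (Fin n → ℝ) × (Fin n → ℝ) => (q.1, q.1 + q.2) :=
    measurable_fst.prodMk (measurable_fst.add measurable_snd)
  have hr := (h.measurable_shiftDensity n).ennreal_ofReal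
  refine ⟨hm, Measure.ext fun s hs => ?_⟩
  rw [Measure.map_apply hm hs, Measure.prod_apply (hm hs), withDensity_apply _ hs,
    ← lintegral_indicator hs, lintegral_prod _ (hr.indicator hs).aemeasurable]
  refine lintegral_congr_ae ?_
  filter_upwards [hπ] with x hx
  have hsx : MeasurableSet (Prod.mk x ⁻¹' s) := measurable_prodMk_left hs
  have hshift := Measure.map_apply (μ := noiseLaw p n) (measurable_const_add x) hsx
  rw [h.map_const_add_noiseLaw_eq_withDensity hx, withDensity_apply _ hsx,
    ← lintegral_indicator hsx] at hshift
  exact hshift.symm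

namespace IsTiltingInput

variable [IsProbabilityMeasure μ]

theorem measurePreserving_add (hμ : IsTiltingInput p γ μ) (h : RegularDensity p b ζ) (n : ℕ) :
    MeasurePreserving (fun q : (Fin n → ℝ) × (Fin n → ℝ) => q.1 + q.2) (inputNoiseLaw p μ n)
      (tiltedNoiseLaw p γ n) := by
  have := h.isProbabilityMeasure
  have := Measure.isProbabilityMeasure_map (μ := μ.prod (lawOf p)) hμ.aemeasurable
  have hadd : Measurable fun q : (Fin n → ℝ) × (Fin n → ℝ) => q.1 + q.2 :=
    measurable_fst.add measurable_snd
  have hcoords := h.measurePreserving_coords μ n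
  have hpi := Measure.pi_map_pi (μ := fun _ : Fin n => μ.prod (lawOf p))
    (f := fun _ q => q.1 + q.2) fun _ => hμ.aemeasurable
  rw [hμ.map_eq] at hpi
  refine ⟨hadd, ?_⟩
  rw [← hcoords.map_eq, Measure.map_map hadd hcoords.measurable]
  exact hpi

theorem ae_pos_add (hμ : IsTiltingInput p γ μ) (h : RegularDensity p b ζ) (hγ : γ ≤ 1 - ζ)
    (n : ℕ) : ∀ᵐ q ∂(inputNoiseLaw p μ n), ∀ i, 0 < p (q.1 i + q.2 i) :=
  (hμ.measurePreserving_add h n).quasiMeasurePreserving.ae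
    ((h.tiltedNoiseLaw_absolutelyContinuous hγ n).ae_le (h.ae_pos_noiseLaw n))

theorem ae_ae_pos_add (hμ : IsTiltingInput p γ μ) (h : RegularDensity p b ζ) (hγ : γ ≤ 1 - ζ)
    (n : ℕ) :
    ∀ᵐ x ∂(Measure.pi fun _ : Fin n => μ), ∀ᵐ z ∂(noiseLaw p n), ∀ i, 0 < p (x i + z i) := by
  have := h.isProbabilityMeasure_noiseLaw n
  exact Measure.ae_ae_of_ae_prod (hμ.ae_pos_add h hγ n)

theorem integrable_comp_joint_iff (hμ : IsTiltingInput p γ μ) (h : RegularDensity p b ζ)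
    (hγ : γ ≤ 1 - ζ) {n : ℕ} {F : (Fin n → ℝ) × (Fin n → ℝ) → ℝ} (hF : Measurable F) :
    Integrable (fun q => F (q.1, q.1 + q.2)) (inputNoiseLaw p μ n)
      ↔ Integrable (fun q => shiftDensity p q.1 q.2 * F q) (inputNoiseLaw p μ n) := by
  rw [← integrable_withDensity_ofReal_iff (h.measurable_shiftDensity n)
    fun q => h.shiftDensity_nonneg q.1 q.2]
  exact (h.measurePreserving_prodMk_add (hμ.ae_ae_pos_add h hγ n)).integrable_comp
    hF.aestronglyMeasurable

theorem integral_comp_joint (hμ : IsTiltingInput p γ μ) (h : RegularDensity p b ζ)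
    (hγ : γ ≤ 1 - ζ) {n : ℕ} {F : (Fin n → ℝ) × (Fin n → ℝ) → ℝ} (hF : Measurable F) :
    ∫ q, F (q.1, q.1 + q.2) ∂(inputNoiseLaw p μ n)
      = ∫ q, shiftDensity p q.1 q.2 * F q ∂(inputNoiseLaw p μ n) := by
  rw [← integral_withDensity_ofReal (h.measurable_shiftDensity n)
    fun q => h.shiftDensity_nonneg q.1 q.2]
  exact integral_comp_measurePreserving (h.measurePreserving_prodMk_add (hμ.ae_ae_pos_add h hγ n))
    hF.aestronglyMeasurable

theorem integrable_totalSurprisal_add (hμ : IsTiltingInput p γ μ) (h : RegularDensity p b ζ)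
    (hγ : γ < 1 - ζ) (n : ℕ) :
    Integrable (fun q : (Fin n → ℝ) × (Fin n → ℝ) => totalSurprisal p (q.1 + q.2))
      (inputNoiseLaw p μ n) :=
  (hμ.measurePreserving_add h n).integrable_comp_of_integrable
    (h.integrable_totalSurprisal_tiltedNoiseLaw hγ n)

theorem integral_totalSurprisal_add (hμ : IsTiltingInput p γ μ) (h : RegularDensity p b ζ)
    (hγ : γ < 1 - ζ) (n : ℕ) :
    ∫ q, totalSurprisal p (q.1 + q.2) ∂(inputNoiseLaw p μ n)
      = n * deriv (surprisalCgf p) γ := by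
  rw [← h.integral_totalSurprisal_tiltedNoiseLaw hγ]
  exact integral_comp_measurePreserving (hμ.measurePreserving_add h n)
    (h.measurable_totalSurprisal n).aestronglyMeasurable

theorem log_shiftDensity_ae (hμ : IsTiltingInput p γ μ) (h : RegularDensity p b ζ)
    (hγ : γ ≤ 1 - ζ) (n : ℕ) :
    (fun q : (Fin n → ℝ) × (Fin n → ℝ) => Real.log (shiftDensity p q.1 (q.1 + q.2)))
      =ᵐ[inputNoiseLaw p μ n] fun q => totalSurprisal p (q.1 + q.2) - totalSurprisal p q.2 := by
  have := h.isProbabilityMeasure_noiseLaw n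
  have hnoise : ∀ᵐ q ∂(inputNoiseLaw p μ n), ∀ i, 0 < p (q.2 i) :=
    Measure.quasiMeasurePreserving_snd.ae (h.ae_pos_noiseLaw n)
  filter_upwards [hμ.ae_pos_add h hγ n, hnoise] with q hadd hq
  exact log_shiftDensity_add hq hadd

theorem integrable_mul_log_shiftDensity (hμ : IsTiltingInput p γ μ) (h : RegularDensity p b ζ)
    (hγ : γ < 1 - ζ) (n : ℕ) :
    Integrable (fun q : (Fin n → ℝ) × (Fin n → ℝ) =>
      shiftDensity p q.1 q.2 * Real.log (shiftDensity p q.1 q.2)) (inputNoiseLaw p μ n) := by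
  have := h.isProbabilityMeasure_noiseLaw n
  refine (hμ.integrable_comp_joint_iff h hγ.le (h.measurable_shiftDensity n).log).1 ?_
  exact ((hμ.integrable_totalSurprisal_add h hγ n).sub
    ((h.integrable_totalSurprisal n).comp_snd _)).congr (hμ.log_shiftDensity_ae h hγ.le n).symm

theorem integral_mul_log_shiftDensity (hμ : IsTiltingInput p γ μ) (h : RegularDensity p b ζ)
    (hγ : γ < 1 - ζ) (n : ℕ) :
    ∫ q, shiftDensity p q.1 q.2 * Real.log (shiftDensity p q.1 q.2) ∂(inputNoiseLaw p μ n)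
      = n * deriv (surprisalCgf p) γ - n * diffEntropy p := by
  have := h.isProbabilityMeasure_noiseLaw n
  have hnoise : ∫ q, totalSurprisal p q.2 ∂(inputNoiseLaw p μ n) = n * diffEntropy p := by
    rw [← h.integral_totalSurprisal n]
    exact integral_comp_measurePreserving measurePreserving_snd
      (h.measurable_totalSurprisal n).aestronglyMeasurable
  rw [← hμ.integral_comp_joint h hγ.le (h.measurable_shiftDensity n).log,
    integral_congr_ae (hμ.log_shiftDensity_ae h hγ.le n),
    integral_sub (hμ.integrable_totalSurprisal_add h hγ n)
      ((h.integrable_totalSurprisal n).comp_snd _),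
    hμ.integral_totalSurprisal_add h hγ, hnoise]

theorem integrable_mul_log_tiltedNoiseDensity (hμ : IsTiltingInput p γ μ)
    (h : RegularDensity p b ζ) (hγ : γ < 1 - ζ) (n : ℕ) :
    Integrable (fun q : (Fin n → ℝ) × (Fin n → ℝ) =>
      shiftDensity p q.1 q.2 * Real.log (tiltedNoiseDensity p γ q.2)) (inputNoiseLaw p μ n) := by
  have := h.isProbabilityMeasure_noiseLaw n
  refine (hμ.integrable_comp_joint_iff h hγ.le
    ((h.measurable_tiltedNoiseDensity γ n).comp measurable_snd).log).1 ?_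
  simp only [Function.comp_apply, log_tiltedNoiseDensity]
  exact ((hμ.integrable_totalSurprisal_add h hγ n).const_mul γ).sub (integrable_const _)

theorem integral_mul_log_tiltedNoiseDensity (hμ : IsTiltingInput p γ μ)
    (h : RegularDensity p b ζ) (hγ : γ < 1 - ζ) (n : ℕ) :
    ∫ q, shiftDensity p q.1 q.2 * Real.log (tiltedNoiseDensity p γ q.2) ∂(inputNoiseLaw p μ n)
      = n * (γ * deriv (surprisalCgf p) γ - surprisalCgf p γ) := by
  have := h.isProbabilityMeasure_noiseLaw n
  have hjoint := hμ.integral_comp_joint h hγ.le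
    ((h.measurable_tiltedNoiseDensity γ n).comp measurable_snd).log
  simp only [Function.comp_apply] at hjoint
  rw [← hjoint]
  simp only [log_tiltedNoiseDensity]
  rw [integral_sub ((hμ.integrable_totalSurprisal_add h hγ n).const_mul γ) (integrable_const _),
    integral_const_mul, hμ.integral_totalSurprisal_add h hγ, integral_const, probReal_univ,
    one_smul]
  ring

theorem lintegral_shiftDensity_input (hμ : IsTiltingInput p γ μ) (h : RegularDensity p b ζ)
    (hγ : γ ≤ 1 - ζ) (n : ℕ) :
    ∀ᵐ y ∂(noiseLaw p n),
      ∫⁻ x, ENNReal.ofReal (shiftDensity p x y) ∂(Measure.pi fun _ : Fin n => μ)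
        = ENNReal.ofReal (tiltedNoiseDensity p γ y) := by
  have := h.isProbabilityMeasure_noiseLaw n
  have hr := (h.measurable_shiftDensity n).ennreal_ofReal
  have hjoint := h.measurePreserving_prodMk_add (hμ.ae_ae_pos_add h hγ n)
  refine (withDensity_eq_iff_of_sigmaFinite hr.lintegral_prod_left'.aemeasurable
    (h.measurable_tiltedNoiseDensity γ n).ennreal_ofReal.aemeasurable).1 ?_
  rw [← h.tiltedNoiseLaw_eq_withDensity hγ, ← (hμ.measurePreserving_add h n).map_eq,
    ← map_snd_withDensity_prod _ _ hr, ← hjoint.map_eq,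
    Measure.map_map measurable_snd hjoint.measurable]
  rfl

theorem isChannelDensity (hμ : IsTiltingInput p γ μ) (h : RegularDensity p b ζ)
    (hγ : γ < 1 - ζ) (n : ℕ) :
    IsChannelDensity (Measure.pi fun _ : Fin n => μ) (noiseLaw p n) (shiftDensity p)
      (tiltedNoiseDensity p γ) where
  measurable := h.measurable_shiftDensity n
  nonneg := h.shiftDensity_nonneg
  measurable_output := h.measurable_tiltedNoiseDensity γ n
  output_pos := tiltedNoiseDensity_pos γ
  lintegral_eq_one := by
    filter_upwards [hμ.ae_ae_pos_add h hγ.le n] with x hx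
    have huniv := (h.isProbabilityMeasure_map_const_add x).measure_univ
    rwa [h.map_const_add_noiseLaw_eq_withDensity hx, withDensity_apply _ MeasurableSet.univ,
      Measure.restrict_univ] at huniv
  lintegral_input := hμ.lintegral_shiftDensity_input h hγ.le n
  integrable_mul_log := hμ.integrable_mul_log_shiftDensity h hγ n
  integrable_mul_log_output := hμ.integrable_mul_log_tiltedNoiseDensity h hγ n

end IsTiltingInput

end Input

section LogComparison

variable {s u v T r : ℝ}

theorem sq_max_sub_le (hs : 0 < s) (a T : ℝ) :
    (max (a - T) 0) ^ 2 ≤ 2 / s ^ 2 * Real.exp (-(s * T)) * Real.exp (s * a) := by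
  rw [mul_assoc, ← Real.exp_add, show -(s * T) + s * a = s * (a - T) by ring]
  rcases le_total (a - T) 0 with hle | hle
  · rw [max_eq_right hle, zero_pow two_ne_zero]
    positivity
  · rw [max_eq_left hle, div_mul_eq_mul_div, le_div_iff₀ (by positivity)]
    have hexp := Real.quadratic_le_exp_of_nonneg (mul_nonneg hs.le hle)
    linarith [mul_nonneg hs.le hle, mul_pow s (a - T) 2]

theorem min_neg_log (hu : 0 < u) (T : ℝ) :
    min (-Real.log u) T = -Real.log (max u (Real.exp (-T))) := by
  rcases le_total u (Real.exp (-T)) with hle | hle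
  · rw [max_eq_right hle, Real.log_exp, neg_neg, min_eq_right]
    linarith [(Real.log_le_iff_le_exp hu).2 hle]
  · rw [max_eq_left hle, min_eq_left]
    linarith [(Real.le_log_iff_exp_le hu).2 hle]

theorem sq_log_sub_log_le (hu : 0 < u) (huv : u ≤ v) :
    (Real.log v - Real.log u) ^ 2 ≤ 4 * (√v - √u) ^ 2 / u := by
  have hv : 0 < v := hu.trans_le huv
  have hsu : 0 < √u := Real.sqrt_pos.2 hu
  have hsv : 0 < √v := Real.sqrt_pos.2 hv
  have hlog : Real.log v - Real.log u ≤ 2 * ((√v - √u) / √u) := by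
    have := Real.log_le_sub_one_of_pos (div_pos hsv hsu)
    rw [Real.log_div hsv.ne' hsu.ne', Real.log_sqrt hv.le, Real.log_sqrt hu.le] at this
    rw [sub_div, div_self hsu.ne']
    linarith
  calc
    _ ≤ (2 * ((√v - √u) / √u)) ^ 2 :=
      pow_le_pow_left₀ (sub_nonneg.2 (Real.log_le_log hu huv)) hlog 2
    _ = _ := by rw [mul_pow, div_pow, Real.sq_sqrt hu.le]; ring

theorem sq_min_neg_log_sub_le (hu : 0 < u) (hv : 0 < v) (T : ℝ) :
    (min (-Real.log u) T - min (-Real.log v) T) ^ 2 ≤ 4 * Real.exp T * (√u - √v) ^ 2 := by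
  wlog huv : u ≤ v generalizing u v
  · have hswap := this hv hu (le_of_not_ge huv)
    rwa [sub_sq_comm, sub_sq_comm (√u)]
  set e := Real.exp (-T) with he
  have hsqrt : (√(max v e) - √(max u e)) ^ 2 ≤ (√u - √v) ^ 2 := by
    rw [Real.sqrt_monotone.map_max, Real.sqrt_monotone.map_max, sub_sq_comm (√u)]
    exact sq_le_sq.2 (abs_max_sub_max_le_abs _ _ _)
  calc
    _ = (Real.log (max v e) - Real.log (max u e)) ^ 2 := by
      rw [min_neg_log hu, min_neg_log hv]; ring
    _ ≤ 4 * (√(max v e) - √(max u e)) ^ 2 / max u e :=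
      sq_log_sub_log_le (lt_max_of_lt_left hu) (max_le_max_right e huv)
    _ ≤ 4 * (√u - √v) ^ 2 / e := by
      have := Real.exp_pos (-T)
      gcongr
      exact le_max_right u e
    _ = _ := by rw [he, Real.exp_neg, div_inv_eq_mul]; ring

/- Below the level `T` the logarithms are compared through square roots, above it through
exponential moments. -/
theorem sq_neg_log_sub_le (hs : 0 < s) (hu : 0 < u) (hv : 0 < v) (T : ℝ) :
    (-Real.log u - -Real.log v) ^ 2 ≤
      6 / s ^ 2 * Real.exp (-(s * T)) * (Real.exp (s * -Real.log u) + Real.exp (s * -Real.log v))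
        + 12 * Real.exp T * (√u - √v) ^ 2 := by
  have htail_u := sq_max_sub_le hs (-Real.log u) T
  have htail_v := sq_max_sub_le hs (-Real.log v) T
  have htrunc := sq_min_neg_log_sub_le hu hv T
  have hsplit : ∀ x : ℝ, x = min x T + max (x - T) 0 := fun x => by
    rw [← sub_self T, max_sub_sub_right]
    linarith [min_add_max x T]
  have hsplit_u := hsplit (-Real.log u)
  have hsplit_v := hsplit (-Real.log v)
  set A := max (-Real.log u - T) 0
  set B := max (-Real.log v - T) 0
  set C := min (-Real.log u) T - min (-Real.log v) T
  have hABC : -Real.log u - -Real.log v = A - B + C := by linarith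
  rw [hABC, show 6 / s ^ 2 = 3 * (2 / s ^ 2) by ring]
  nlinarith [sq_nonneg (A + B), sq_nonneg (A - C), sq_nonneg (B + C)]

theorem sq_one_sub_sqrt_le (hr : 0 ≤ r) : (1 - √r) ^ 2 ≤ r * Real.log r + 1 - r := by
  rcases hr.eq_or_lt with hzero | hpos
  · simp [← hzero]
  have hsqrt : 0 < √r := Real.sqrt_pos.2 hpos
  have hlog := Real.one_sub_inv_le_log_of_pos hsqrt
  rw [Real.log_sqrt hr] at hlog
  have hmul : r * (1 - (√r)⁻¹) = r - √r := by
    rw [mul_sub, mul_one, ← div_eq_mul_inv, Real.div_sqrt]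
  linarith [mul_le_mul_of_nonneg_left hlog hr, Real.sq_sqrt hr, sub_sq 1 (√r)]

end LogComparison

section Concentration

variable {p : ℝ → ℝ} {b ζ γ : ℝ} {μ : Measure ℝ}

/-- The single-letter information density of the tilting input, as a function of input and noise,
without its constant `surprisalCgf p γ`. -/
noncomputable def infoDensity (p : ℝ → ℝ) (γ : ℝ) (q : ℝ × ℝ) : ℝ :=
  (1 - γ) * surprisal p (q.1 + q.2) - surprisal p q.2

theorem sum_infoDensity {n : ℕ} (x z : Fin n → ℝ) :
    ∑ i, infoDensity p γ (x i, z i)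
      = (1 - γ) * totalSurprisal p (x + z) - totalSurprisal p z := by
  simp only [infoDensity, totalSurprisal, Finset.sum_sub_distrib, Finset.mul_sum, Pi.add_apply]

theorem sum_infoDensity_le {n : ℕ} {t : ℝ} (ht : 0 < t) {x z : Fin n → ℝ}
    (hz : ∀ i, 0 < p (z i)) (hx : ∀ i, 0 < p (x i + z i))
    (hle : shiftDensity p x (x + z) ≤ t * tiltedNoiseDensity p γ (x + z)) :
    ∑ i, infoDensity p γ (x i, z i) ≤ Real.log t - n * surprisalCgf p γ := by
  have hlog := Real.log_le_log (shiftDensity_add_pos hz hx) hle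
  rw [log_shiftDensity_add hz hx, Real.log_mul ht.ne' (tiltedNoiseDensity_pos γ _).ne',
    log_tiltedNoiseDensity] at hlog
  rw [sum_infoDensity]
  linarith

namespace RegularDensity

theorem measurable_sq_sqrt_sub (h : RegularDensity p b ζ) :
    Measurable fun q : ℝ × ℝ => (√(p (q.1 + q.2)) - √(p q.2)) ^ 2 :=
  ((h.measurable.comp (measurable_fst.add measurable_snd)).sqrt.sub
    (h.measurable.comp measurable_snd).sqrt).pow_const 2

theorem integrable_sq_sqrt_sub (h : RegularDensity p b ζ) (ρ : Measure (ℝ × ℝ))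
    [IsFiniteMeasure ρ] :
    Integrable (fun q : ℝ × ℝ => (√(p (q.1 + q.2)) - √(p q.2)) ^ 2) ρ := by
  refine (integrable_const b).mono' h.measurable_sq_sqrt_sub.aestronglyMeasurable
    (ae_of_all _ fun q => ?_)
  have hsqrt : ∀ z, √(p z) ≤ √b := fun z => Real.sqrt_le_sqrt (h.le_bound z)
  have habs : |√(p (q.1 + q.2)) - √(p q.2)| ≤ √b :=
    abs_sub_le_of_nonneg_of_le (Real.sqrt_nonneg _) (hsqrt _) (Real.sqrt_nonneg _) (hsqrt _)
  calc
    _ = |√(p (q.1 + q.2)) - √(p q.2)| ^ 2 := by rw [Real.norm_of_nonneg (sq_nonneg _), sq_abs]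
    _ ≤ √b ^ 2 := pow_le_pow_left₀ (abs_nonneg _) habs 2
    _ = b := Real.sq_sqrt (zero_le_one.trans h.one_le)

theorem shiftDensity_mul_sq_sqrt_sub_le (h : RegularDensity p b ζ) {x y : Fin 1 → ℝ}
    (hy : 0 < p (y 0)) :
    shiftDensity p x y * (√(p (y 0)) - √(p (y 0 - x 0))) ^ 2
      ≤ b * (shiftDensity p x y * Real.log (shiftDensity p x y) + 1 - shiftDensity p x y) := by
  have hr : 0 ≤ shiftDensity p x y := h.shiftDensity_nonneg x y
  have hshift : p (y 0 - x 0) = shiftDensity p x y * p (y 0) := by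
    simp [shiftDensity, hy.ne']
  set r := shiftDensity p x y
  have hb : r * p (y 0) ≤ b := hshift ▸ h.le_bound _
  calc
    _ = r * p (y 0) * (1 - √r) ^ 2 := by
      rw [hshift, Real.sqrt_mul hr]
      linear_combination r * (1 - √r) ^ 2 * Real.sq_sqrt hy.le
    _ ≤ b * (1 - √r) ^ 2 := by gcongr
    _ ≤ _ := by
      have := h.one_le
      gcongr
      exact sq_one_sub_sqrt_le hr

end RegularDensity

namespace IsTiltingInput

theorem sq_infoDensity_ae_le (hμ : IsTiltingInput p γ μ) (h : RegularDensity p b ζ)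
    {s : ℝ} (hs : 0 < s) (T : ℝ) :
    ∀ᵐ q ∂(μ.prod (lawOf p)), infoDensity p γ q ^ 2 ≤
      2 * (6 / s ^ 2 * Real.exp (-(s * T)) *
          (Real.exp (s * surprisal p (q.1 + q.2)) + Real.exp (s * surprisal p q.2))
        + 12 * Real.exp T * (√(p (q.1 + q.2)) - √(p q.2)) ^ 2)
      + 2 * γ ^ 2 * surprisal p (q.1 + q.2) ^ 2 := by
  have := h.isProbabilityMeasure
  have habs : tiltedLaw p γ ≪ lawOf p := tilted_absolutelyContinuous _ _
  have hadd : ∀ᵐ q ∂(μ.prod (lawOf p)), 0 < p (q.1 + q.2) :=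
    hμ.quasiMeasurePreserving.ae (habs.ae_le h.ae_pos)
  have hnoise : ∀ᵐ q ∂(μ.prod (lawOf p)), 0 < p q.2 :=
    Measure.quasiMeasurePreserving_snd.ae h.ae_pos
  filter_upwards [hadd, hnoise] with q hq hq'
  have hlog := sq_neg_log_sub_le hs hq hq' T
  simp only [infoDensity, surprisal]
  nlinarith [sq_nonneg (-Real.log (p (q.1 + q.2)) - -Real.log (p q.2)
    + γ * -Real.log (p (q.1 + q.2)))]

variable [IsProbabilityMeasure μ]

theorem memLp_infoDensity (hμ : IsTiltingInput p γ μ) (h : RegularDensity p b ζ)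
    (hγ : γ < 1 - ζ) : MemLp (infoDensity p γ) 2 (μ.prod (lawOf p)) := by
  have := h.isProbabilityMeasure
  exact (((h.memLp_surprisal_tiltedLaw hγ).comp_measurePreserving hμ).const_mul (1 - γ)).sub
    (h.memLp_surprisal.comp_measurePreserving measurePreserving_snd)

theorem integral_infoDensity (hμ : IsTiltingInput p γ μ) (h : RegularDensity p b ζ)
    (hγ : γ < 1 - ζ) :
    ∫ q, infoDensity p γ q ∂(μ.prod (lawOf p))
      = (1 - γ) * deriv (surprisalCgf p) γ - diffEntropy p := by
  have := h.isProbabilityMeasure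
  have := h.isProbabilityMeasure_tiltedLaw hγ.le
  have hmeas := h.measurable_surprisal.aestronglyMeasurable (μ := lawOf p)
  have hmeas' := h.measurable_surprisal.aestronglyMeasurable (μ := tiltedLaw p γ)
  have hadd : Integrable (fun q : ℝ × ℝ => surprisal p (q.1 + q.2)) (μ.prod (lawOf p)) :=
    hμ.integrable_comp_of_integrable ((h.memLp_surprisal_tiltedLaw hγ).integrable (by norm_num))
  simp only [infoDensity]
  rw [integral_sub (hadd.const_mul _) (h.integrable_surprisal.comp_snd μ), integral_const_mul,
    integral_comp_measurePreserving hμ hmeas',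
    integral_comp_measurePreserving measurePreserving_snd hmeas,
    h.integral_surprisal_tiltedLaw hγ]

theorem lintegral_threshold_le (hμ : IsTiltingInput p γ μ) (h : RegularDensity p b ζ)
    (hγ : γ < 1 - ζ) (n : ℕ) {t c : ℝ} (ht : 0 < t) (hc : 0 < c)
    (htc : Real.log t + c
      ≤ n * (∫ q, infoDensity p γ q ∂(μ.prod (lawOf p)) + surprisalCgf p γ)) :
    ∫⁻ q in {q | shiftDensity p q.1 q.2 ≤ t * tiltedNoiseDensity p γ q.2},
        ENNReal.ofReal (shiftDensity p q.1 q.2) ∂(inputNoiseLaw p μ n)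
      ≤ ENNReal.ofReal (n * Var[infoDensity p γ; μ.prod (lawOf p)] / c ^ 2) := by
  have := h.isProbabilityMeasure
  have := h.isProbabilityMeasure_noiseLaw n
  have hset : MeasurableSet {q : (Fin n → ℝ) × (Fin n → ℝ) |
      shiftDensity p q.1 q.2 ≤ t * tiltedNoiseDensity p γ q.2} :=
    measurableSet_le (h.measurable_shiftDensity n)
      (((h.measurable_tiltedNoiseDensity γ n).comp measurable_snd).const_mul t)
  have hcoords := h.measurePreserving_coords μ n
  have hjoint := (h.measurePreserving_prodMk_add (hμ.ae_ae_pos_add h hγ.le n)).comp hcoords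
  have hinfo := hμ.memLp_infoDensity h hγ
  set P := Measure.pi fun _ : Fin n => μ.prod (lawOf p) with hP
  set S : (Fin n → ℝ × ℝ) → ℝ := ∑ i, fun q => infoDensity p γ (q i) with hS
  have hmem : MemLp S 2 P := memLp_finsetSum' _ fun i _ =>
    hinfo.comp_measurePreserving (measurePreserving_eval (fun _ => μ.prod (lawOf p)) i)
  have hvar : Var[S; P] = n * Var[infoDensity p γ; μ.prod (lawOf p)] := by
    rw [hS, hP, variance_sum_pi fun _ => hinfo]
    simp
  have hint : ∫ q, S q ∂P = n * ∫ q, infoDensity p γ q ∂(μ.prod (lawOf p)) := by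
    simp only [hS, Finset.sum_apply]
    rw [integral_sum_comp_eval (hinfo.integrable (by norm_num)), Fintype.card_fin]
  have hnoise : ∀ᵐ q ∂(inputNoiseLaw p μ n), ∀ i, 0 < p (q.2 i) :=
    Measure.quasiMeasurePreserving_snd.ae (h.ae_pos_noiseLaw n)
  rw [← withDensity_apply _ hset, ← hjoint.measure_preimage hset.nullMeasurableSet, ← hvar]
  refine le_trans (measure_mono_ae ?_) (meas_ge_le_variance_div_sq hmem hc)
  filter_upwards [hcoords.quasiMeasurePreserving.ae (hμ.ae_pos_add h hγ.le n),
    hcoords.quasiMeasurePreserving.ae hnoise] with q hadd hz hq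
  have hsum : S q ≤ Real.log t - n * surprisalCgf p γ := by
    simpa only [hS, Finset.sum_apply] using sum_infoDensity_le ht hz hadd hq
  refine le_trans ?_ (neg_le_abs _)
  rw [hint]
  linarith

theorem integral_sq_sqrt_sub_le (hμ : IsTiltingInput p γ μ) (h : RegularDensity p b ζ)
    (hγ : γ < 1 - ζ) :
    ∫ q, (√(p (q.1 + q.2)) - √(p q.2)) ^ 2 ∂(μ.prod (lawOf p))
      ≤ b * (deriv (surprisalCgf p) γ - diffEntropy p) := by
  have := h.isProbabilityMeasure
  have := h.isProbabilityMeasure_noiseLaw 1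
  have hchannel := hμ.isChannelDensity h hγ 1
  have hlog := hμ.integrable_mul_log_shiftDensity h hγ 1
  have hlog1 := hlog.fun_add (integrable_const 1)
  have hcoord : MeasurePreserving (fun q : (Fin 1 → ℝ) × (Fin 1 → ℝ) => (q.1 0, q.2 0))
      (inputNoiseLaw p μ 1) (μ.prod (lawOf p)) :=
    (measurePreserving_eval (fun _ : Fin 1 => μ) 0).prod
      (measurePreserving_eval (fun _ : Fin 1 => lawOf p) 0)
  have hmeas : Measurable fun q : (Fin 1 → ℝ) × (Fin 1 → ℝ) =>
      (√(p (q.2 0)) - √(p (q.2 0 - q.1 0))) ^ 2 := by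
    have := h.measurable
    fun_prop
  have hjoint := hμ.integral_comp_joint h hγ.le hmeas
  simp only [Pi.add_apply, add_sub_cancel_left] at hjoint
  rw [← integral_comp_measurePreserving hcoord h.measurable_sq_sqrt_sub.aestronglyMeasurable]
  simp only
  rw [hjoint]
  calc
    _ ≤ ∫ q, b * (shiftDensity p q.1 q.2 * Real.log (shiftDensity p q.1 q.2) + 1
        - shiftDensity p q.1 q.2) ∂(inputNoiseLaw p μ 1) := by
      refine integral_mono_of_nonneg
        (ae_of_all _ fun q => mul_nonneg (h.shiftDensity_nonneg _ _) (sq_nonneg _))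
        ((hlog1.sub hchannel.integrable).const_mul b) ?_
      filter_upwards [Measure.quasiMeasurePreserving_snd.ae (h.ae_pos_noiseLaw 1)] with q hq
      exact h.shiftDensity_mul_sq_sqrt_sub_le (hq 0)
    _ = _ := by
      rw [integral_const_mul, integral_sub hlog1 hchannel.integrable,
        integral_add hlog (integrable_const 1), hμ.integral_mul_log_shiftDensity h hγ,
        hchannel.integral_prod_eq_one]
      simp

theorem variance_infoDensity_le (hμ : IsTiltingInput p γ μ) (h : RegularDensity p b ζ)
    {s : ℝ} (hs0 : 0 < s) (hγ : γ < 1 - ζ) (hs : s ≤ 1 - ζ) (hsγ : s + γ ≤ 1 - ζ) (T : ℝ) :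
    Var[infoDensity p γ; μ.prod (lawOf p)] ≤
      2 * (6 / s ^ 2 * Real.exp (-(s * T)) *
          (Real.exp (surprisalCgf p (s + γ) - surprisalCgf p γ) + Real.exp (surprisalCgf p s))
        + 12 * Real.exp T * (b * (deriv (surprisalCgf p) γ - diffEntropy p)))
      + 2 * γ ^ 2 * (iteratedDeriv 2 (surprisalCgf p) γ + deriv (surprisalCgf p) γ ^ 2) := by
  have := h.isProbabilityMeasure
  have hexp := h.integrable_exp_surprisal_tiltedLaw hγ.le hsγ
  have hexp' := h.integrable_exp_surprisal hs
  have hsq := (h.memLp_surprisal_tiltedLaw hγ).integrable_sq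
  have iadd : Integrable (fun q : ℝ × ℝ => Real.exp (s * surprisal p (q.1 + q.2)))
      (μ.prod (lawOf p)) := hμ.integrable_comp_of_integrable hexp
  have inoise : Integrable (fun q : ℝ × ℝ => Real.exp (s * surprisal p q.2))
      (μ.prod (lawOf p)) := hexp'.comp_snd μ
  have isq : Integrable (fun q : ℝ × ℝ => surprisal p (q.1 + q.2) ^ 2) (μ.prod (lawOf p)) :=
    hμ.integrable_comp_of_integrable hsq
  have vadd := (integral_comp_measurePreserving hμ hexp.1).trans
    (h.integral_exp_surprisal_tiltedLaw hγ.le hsγ)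
  have vnoise := (integral_comp_measurePreserving (measurePreserving_snd (μ := μ)) hexp'.1).trans
    (h.integral_exp_surprisal hs)
  have vsq := (integral_comp_measurePreserving hμ hsq.1).trans
    (h.integral_sq_surprisal_tiltedLaw hγ)
  have itail := (iadd.fun_add inoise).const_mul (6 / s ^ 2 * Real.exp (-(s * T)))
  have ihell := (h.integrable_sq_sqrt_sub (μ.prod (lawOf p))).const_mul (12 * Real.exp T)
  refine (variance_le_expectation_sq (hμ.memLp_infoDensity h hγ).1).trans ?_
  refine (integral_mono_of_nonneg (ae_of_all _ fun q => sq_nonneg _)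
    (((itail.fun_add ihell).const_mul 2).fun_add (isq.const_mul _))
    (hμ.sq_infoDensity_ae_le h hs0 T)).trans ?_
  rw [integral_add ((itail.fun_add ihell).const_mul 2) (isq.const_mul _), integral_const_mul,
    integral_add itail ihell, integral_const_mul, integral_add iadd inoise,
    integral_const_mul, integral_const_mul, vadd, vnoise, vsq]
  gcongr
  exact hμ.integral_sq_sqrt_sub_le h hγ

end IsTiltingInput

end Concentration

section Expansion

variable {p : ℝ → ℝ} {b ζ : ℝ}

theorem exists_mul_exp_neg_mul_lt {s ρ : ℝ} (hs : 0 < s) (hρ : 0 < ρ) (C : ℝ) :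
    ∃ T : ℝ, 2 * (6 / s ^ 2 * Real.exp (-(s * T)) * C) < ρ := by
  have hexp : Tendsto (fun T => Real.exp (-(s * T))) atTop (𝓝 0) :=
    Real.tendsto_exp_neg_atTop_nhds_zero.comp (tendsto_id.const_mul_atTop hs)
  have htail := ((hexp.const_mul (6 / s ^ 2)).mul_const C).const_mul 2
  rw [mul_zero, zero_mul, mul_zero] at htail
  exact (htail.eventually_lt_const hρ).exists

namespace RegularDensity

theorem one_sub_exponent_pos (h : RegularDensity p b ζ) : 0 < 1 - ζ :=
  sub_pos.2 h.exponent_mem.2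

theorem analyticAt_surprisalCgf (h : RegularDensity p b ζ) {γ : ℝ} (hγ : γ < 1 - ζ) :
    AnalyticAt ℝ (surprisalCgf p) γ :=
  analyticAt_cgf (h.mem_interior_integrableExpSet hγ)

theorem surprisalCgf_zero (h : RegularDensity p b ζ) : surprisalCgf p 0 = 0 := by
  have := h.isProbabilityMeasure
  exact cgf_zero

theorem deriv_surprisalCgf_zero (h : RegularDensity p b ζ) :
    deriv (surprisalCgf p) 0 = diffEntropy p := by
  have := h.isProbabilityMeasure
  simp [deriv_cgf_zero h.zero_mem_interior_integrableExpSet]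

theorem deriv_deriv_surprisalCgf_zero (h : RegularDensity p b ζ) :
    deriv (deriv (surprisalCgf p)) 0 = Var[surprisal p; lawOf p] := by
  have := h.isProbabilityMeasure
  have hsecond := iteratedDeriv_two_cgf h.zero_mem_interior_integrableExpSet
  rw [iteratedDeriv_succ, iteratedDeriv_one, h.deriv_surprisalCgf_zero] at hsecond
  rw [hsecond, variance_eq_sub h.memLp_surprisal]
  simp

theorem tendsto_surprisalCgf_div (h : RegularDensity p b ζ) :
    Tendsto (fun γ => surprisalCgf p γ / γ) (𝓝[>] 0) (𝓝 (diffEntropy p)) := by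
  have hderiv := (h.analyticAt_surprisalCgf h.one_sub_exponent_pos).differentiableAt.hasDerivAt
  rw [h.deriv_surprisalCgf_zero] at hderiv
  refine (hderiv.tendsto_slope.mono_left
    (nhdsWithin_mono 0 fun γ (hγ : 0 < γ) => hγ.ne')).congr fun γ => ?_
  rw [slope_def_field, h.surprisalCgf_zero, sub_zero, sub_zero]

theorem tendsto_deriv_surprisalCgf_sub_div (h : RegularDensity p b ζ) :
    Tendsto (fun γ => (deriv (surprisalCgf p) γ - diffEntropy p) / γ) (𝓝[>] 0)
      (𝓝 Var[surprisal p; lawOf p]) := by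
  have hderiv :=
    (h.analyticAt_surprisalCgf h.one_sub_exponent_pos).deriv.differentiableAt.hasDerivAt
  rw [h.deriv_deriv_surprisalCgf_zero] at hderiv
  refine (hderiv.tendsto_slope.mono_left
    (nhdsWithin_mono 0 fun γ (hγ : 0 < γ) => hγ.ne')).congr fun γ => ?_
  rw [slope_def_field, h.deriv_surprisalCgf_zero, sub_zero]

theorem tendsto_surprisalCgf_sub_div_sq (h : RegularDensity p b ζ) :
    Tendsto (fun γ => (surprisalCgf p γ - γ * diffEntropy p) / γ ^ 2) (𝓝[>] 0)
      (𝓝 (Var[surprisal p; lawOf p] / 2)) := by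
  have hpos := h.one_sub_exponent_pos
  have hnum : ContinuousAt (fun γ => surprisalCgf p γ - γ * diffEntropy p) 0 :=
    (h.analyticAt_surprisalCgf hpos).continuousAt.sub (by fun_prop)
  have hden : ContinuousAt (fun γ : ℝ => γ ^ 2) 0 := by fun_prop
  refine HasDerivAt.lhopital_zero_nhdsGT (f' := fun γ => deriv (surprisalCgf p) γ - diffEntropy p)
    (g' := fun γ => 2 * γ) ?_ ?_ ?_ ?_ ?_ ?_
  · filter_upwards [mem_nhdsWithin_of_mem_nhds (Iio_mem_nhds hpos)] with γ hγ
    exact (h.analyticAt_surprisalCgf hγ).differentiableAt.hasDerivAt.sub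
      (hasDerivAt_mul_const (diffEntropy p))
  · exact Eventually.of_forall fun γ => by simpa using hasDerivAt_pow 2 γ
  · filter_upwards [self_mem_nhdsWithin] with γ hγ
    exact mul_ne_zero two_ne_zero (ne_of_gt hγ)
  · simpa [h.surprisalCgf_zero] using hnum.tendsto.mono_left nhdsWithin_le_nhds
  · simpa using hden.tendsto.mono_left nhdsWithin_le_nhds
  · refine (h.tendsto_deriv_surprisalCgf_sub_div.div_const 2).congr fun γ => ?_
    rw [div_div, mul_comm γ]

theorem tendsto_mul_deriv_sub_surprisalCgf_div_sq (h : RegularDensity p b ζ) :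
    Tendsto (fun γ => (γ * deriv (surprisalCgf p) γ - surprisalCgf p γ) / γ ^ 2) (𝓝[>] 0)
      (𝓝 (Var[surprisal p; lawOf p] / 2)) := by
  have hsub := h.tendsto_deriv_surprisalCgf_sub_div.sub h.tendsto_surprisalCgf_sub_div_sq
  rw [sub_half] at hsub
  refine hsub.congr' ?_
  filter_upwards [self_mem_nhdsWithin] with γ hγ
  have : γ ≠ 0 := ne_of_gt hγ
  field_simp
  ring

theorem tendsto_information_div (h : RegularDensity p b ζ) :
    Tendsto (fun γ => ((1 - γ) * deriv (surprisalCgf p) γ - diffEntropy p + surprisalCgf p γ) / γ)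
      (𝓝[>] 0) (𝓝 Var[surprisal p; lawOf p]) := by
  have hderiv : Tendsto (deriv (surprisalCgf p)) (𝓝[>] 0) (𝓝 (diffEntropy p)) := by
    rw [← h.deriv_surprisalCgf_zero]
    exact (h.analyticAt_surprisalCgf
      h.one_sub_exponent_pos).deriv.continuousAt.tendsto.mono_left nhdsWithin_le_nhds
  have hsum := (h.tendsto_deriv_surprisalCgf_sub_div.sub hderiv).add h.tendsto_surprisalCgf_div
  rw [sub_add_cancel] at hsum
  refine hsum.congr' ?_
  filter_upwards [self_mem_nhdsWithin] with γ hγ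
  have : γ ≠ 0 := ne_of_gt hγ
  field_simp
  ring

theorem eventually_variance_infoDensity_le (h : RegularDensity p b ζ) {ρ : ℝ} (hρ : 0 < ρ) :
    ∀ᶠ γ in 𝓝[>] (0 : ℝ), ∀ μ, IsProbabilityMeasure μ → IsTiltingInput p γ μ →
      Var[infoDensity p γ; μ.prod (lawOf p)] ≤ ρ := by
  have hpos := h.one_sub_exponent_pos
  set Λ := surprisalCgf p
  set s := (1 - ζ) / 2
  have hs : 0 < s := half_pos hpos
  have hsζ : s + s = 1 - ζ := add_halves _
  have hanalytic := h.analyticAt_surprisalCgf hpos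
  obtain ⟨T, hT⟩ := exists_mul_exp_neg_mul_lt hs hρ (Real.exp (Λ s) + Real.exp (Λ s))
  have hcont : ContinuousAt (fun γ => 2 * (6 / s ^ 2 * Real.exp (-(s * T)) *
          (Real.exp (Λ (s + γ) - Λ γ) + Real.exp (Λ s))
        + 12 * Real.exp T * (b * (deriv Λ γ - diffEntropy p)))
      + 2 * γ ^ 2 * (iteratedDeriv 2 Λ γ + deriv Λ γ ^ 2)) 0 := by
    have hΛ := hanalytic.continuousAt
    have hderiv := hanalytic.deriv.continuousAt
    have hsecond : ContinuousAt (iteratedDeriv 2 Λ) 0 := by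
      rw [iteratedDeriv_succ, iteratedDeriv_one]
      exact hanalytic.deriv.deriv.continuousAt
    have hshift : ContinuousAt (fun γ => Λ (s + γ)) 0 := by
      have hΛs : ContinuousAt Λ (s + 0) := by
        rw [add_zero]
        exact (h.analyticAt_surprisalCgf (by linarith)).continuousAt
      exact hΛs.comp (f := fun γ => s + γ) (by fun_prop)
    exact (((((hshift.sub hΛ).rexp.add continuousAt_const).const_mul _).add
      (((hderiv.sub continuousAt_const).const_mul b).const_mul _)).const_mul 2).add
      (((continuousAt_id.pow 2).const_mul 2).mul (hsecond.add (hderiv.pow 2)))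
  have hlim := hcont.tendsto.mono_left (nhdsWithin_le_nhds (s := Set.Ioi 0))
  simp only [Λ, add_zero, h.surprisalCgf_zero, sub_zero, h.deriv_surprisalCgf_zero, sub_self,
    mul_zero, zero_pow two_ne_zero, zero_mul] at hlim
  filter_upwards [hlim.eventually_lt_const hT, mem_nhdsWithin_of_mem_nhds (Iio_mem_nhds hs)]
    with γ hγ hγs μ _ hμ
  have hγs : γ < s := hγs
  exact (hμ.variance_infoDensity_le h hs (by linarith) (by linarith) (by linarith) T).trans hγ.le

end RegularDensity

end Expansion

section Achievability

variable {Y : Type*} [MeasurableSpace Y] {ν : Measure Y}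

theorem klDiv_withDensity_ofReal [IsFiniteMeasure ν] {g : Y → ℝ} (hg : Measurable g)
    (hg0 : ∀ y, 0 ≤ g y) [IsFiniteMeasure (ν.withDensity fun y => ENNReal.ofReal (g y))] :
    InformationTheory.klDiv (ν.withDensity fun y => ENNReal.ofReal (g y)) ν
      = ∫⁻ y, ENNReal.ofReal (InformationTheory.klFun (g y)) ∂ν := by
  rw [InformationTheory.klDiv_eq_lintegral_klFun_of_ac (withDensity_absolutelyContinuous _ _)]
  refine lintegral_congr_ae ?_
  filter_upwards [Measure.rnDeriv_withDensity ν hg.ennreal_ofReal] with y hy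
  rw [hy, ENNReal.toReal_ofReal (hg0 y)]

theorem withDensity_const_mul_sum {J : Type*} [Fintype J] {f : J → Y → ℝ≥0∞}
    (hf : ∀ j, Measurable (f j)) (a : ℝ≥0∞) :
    (ν.withDensity fun y => a * ∑ j, f j y) = a • ∑ j, ν.withDensity (f j) := by
  ext s hs
  rw [withDensity_apply _ hs, lintegral_const_mul _ (Finset.measurable_fun_sum _ fun j _ => hf j),
    lintegral_finsetSum _ fun j _ => hf j, Measure.smul_apply, Measure.finsetSum_apply, smul_eq_mul]
  simp only [withDensity_apply _ hs]

theorem le_of_inv_mul_add_le_one {a x y : ℝ≥0∞} (ha : a ≠ 0) (ha' : a ≠ ∞)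
    (h : a⁻¹ * x + y ≤ 1) : x ≤ a := by
  have hle : a⁻¹ * x ≤ 1 := le_self_add.trans h
  rwa [mul_comm, ← div_eq_mul_inv, ENNReal.div_le_iff ha ha', one_mul] at hle

namespace Code

variable {p : ℝ → ℝ} {b ζ : ℝ} {n M K : ℕ} (C : Code n M K)

/-- The codebook of a code, as a family indexed by the pairs of a message and a key. -/
def codebook (j : Fin M × Fin K) : Fin n → ℝ := C.encode j.1 j.2

theorem outputLaw_eq_sum : C.outputLaw p = (Fintype.card (Fin M × Fin K) : ℝ≥0∞)⁻¹ •
    ∑ j, (noiseLaw p n).map fun z => C.codebook j + z := by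
  simp [outputLaw, codebook, Fintype.sum_prod_type, mul_comm]

theorem errorProb_eq_sum : C.errorProb p = (Fintype.card (Fin M × Fin K) : ℝ)⁻¹ *
    ∑ j, (noiseLaw p n).real {z | C.decode (C.codebook j + z) j.2 ≠ j.1} := by
  simp [errorProb, codebook, Fintype.sum_prod_type, mul_comm]

theorem errorProb_eq_toReal (h : RegularDensity p b ζ)
    (hgood : ∀ j, ∀ᵐ z ∂(noiseLaw p n), ∀ i, 0 < p (C.codebook j i + z i)) :
    C.errorProb p = ((Fintype.card (Fin M × Fin K) : ℝ≥0∞)⁻¹ *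
      ∑ j, ∫⁻ y in {y | C.decode y j.2 ≠ j.1},
        ENNReal.ofReal (shiftDensity p (C.codebook j) y) ∂(noiseLaw p n)).toReal := by
  have := h.isProbabilityMeasure_noiseLaw n
  have herr (j : Fin M × Fin K) : ∫⁻ y in {y | C.decode y j.2 ≠ j.1},
        ENNReal.ofReal (shiftDensity p (C.codebook j) y) ∂(noiseLaw p n)
      = noiseLaw p n {z | C.decode (C.codebook j + z) j.2 ≠ j.1} := by
    have hs : MeasurableSet {y | C.decode y j.2 ≠ j.1} := (C.measurableSet_decode j.2 j.1).compl
    rw [← withDensity_apply _ hs, ← h.map_const_add_noiseLaw_eq_withDensity (hgood j),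
      Measure.map_apply (measurable_const_add _) hs]
    rfl
  simp_rw [herr]
  rw [ENNReal.toReal_mul, ENNReal.toReal_sum fun j _ => measure_ne_top _ _, errorProb_eq_sum,
    ENNReal.toReal_inv, ENNReal.toReal_natCast]
  rfl

variable [NeZero M] [NeZero K]

theorem outputLaw_eq_withDensity (h : RegularDensity p b ζ)
    (hgood : ∀ j, ∀ᵐ z ∂(noiseLaw p n), ∀ i, 0 < p (C.codebook j i + z i)) :
    C.outputLaw p = (noiseLaw p n).withDensity fun y =>
      ENNReal.ofReal (codebookDensity (shiftDensity p) C.codebook y) := by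
  simp_rw [ofReal_codebookDensity h.shiftDensity_nonneg, outputLaw_eq_sum,
    h.map_const_add_noiseLaw_eq_withDensity (hgood _)]
  exact (withDensity_const_mul_sum
    (fun j => (h.measurable_shiftDensity_right (C.codebook j)).ennreal_ofReal) _).symm

theorem klDiv_outputLaw (h : RegularDensity p b ζ)
    (hgood : ∀ j, ∀ᵐ z ∂(noiseLaw p n), ∀ i, 0 < p (C.codebook j i + z i)) :
    InformationTheory.klDiv (C.outputLaw p) (noiseLaw p n)
      = ∫⁻ y, ENNReal.ofReal (InformationTheory.klFun
          (codebookDensity (shiftDensity p) C.codebook y)) ∂(noiseLaw p n) := by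
  have := h.isProbabilityMeasure_noiseLaw n
  have hprob := C.isProbabilityMeasure_outputLaw (p := p) (NeZero.pos M) (NeZero.pos K)
  rw [C.outputLaw_eq_withDensity h hgood] at hprob ⊢
  exact klDiv_withDensity_ofReal ((Finset.measurable_fun_sum _ fun j _ =>
    h.measurable_shiftDensity_right (C.codebook j)).const_mul _)
    (codebookDensity_nonneg h.shiftDensity_nonneg _)

end Code

variable {p : ℝ → ℝ} {b ζ γ : ℝ} {n M : ℕ} {Δ ε : ℝ}

theorem inv_ofReal_mul_add_le_one {D e₁ e₂ : ℝ} (hΔ : 0 < Δ) (hε : 0 < ε) (hD : 0 ≤ D)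
    (he₁ : 0 ≤ e₁) (he₂ : 0 ≤ e₂) (hle : D / Δ + (e₁ + e₂) / ε ≤ 1) :
    (ENNReal.ofReal Δ)⁻¹ * ENNReal.ofReal D
      + (ENNReal.ofReal ε)⁻¹ * (ENNReal.ofReal e₁ + ENNReal.ofReal e₂) ≤ 1 := by
  rw [← ENNReal.ofReal_add he₁ he₂, ← ENNReal.ofReal_inv_of_pos hΔ,
    ← ENNReal.ofReal_inv_of_pos hε, ← ENNReal.ofReal_mul (by positivity),
    ← ENNReal.ofReal_mul (by positivity), ← ENNReal.ofReal_add (by positivity) (by positivity),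
    ENNReal.ofReal_le_one, inv_mul_eq_div, inv_mul_eq_div]
  exact hle

namespace RegularDensity

theorem achievable_of_codebookCost_le (h : RegularDensity p b ζ) {K : ℕ} [NeZero M] [NeZero K]
    (hΔ : 0 < Δ) (hε : 0 < ε) {S : Set ((Fin n → ℝ) × (Fin n → ℝ))} (hS : MeasurableSet S)
    {c : Fin M × Fin K → Fin n → ℝ}
    (hgood : ∀ j, ∀ᵐ z ∂(noiseLaw p n), ∀ i, 0 < p (c j i + z i))
    (hcost : codebookCost (shiftDensity p) S (noiseLaw p n) (ENNReal.ofReal Δ)⁻¹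
      (ENNReal.ofReal ε)⁻¹ c ≤ 1) : Achievable p n Δ ε M := by
  let C : Code n M K :=
    ⟨fun m k => c (m, k), typicalDecode S c, measurableSet_typicalDecode hS c⟩
  have hΔ0 : ENNReal.ofReal Δ ≠ 0 := by simpa using hΔ
  have hε0 : ENNReal.ofReal ε ≠ 0 := by simpa using hε
  refine ⟨NeZero.pos M, K, NeZero.pos K, C, ?_, ?_⟩
  · rw [C.klDiv_outputLaw h hgood]
    exact le_of_inv_mul_add_le_one hΔ0 ENNReal.ofReal_ne_top hcost
  · rw [C.errorProb_eq_toReal h hgood]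
    rw [codebookCost, add_comm] at hcost
    refine ENNReal.toReal_le_of_le_ofReal hε.le (le_trans ?_
      (le_of_inv_mul_add_le_one hε0 ENNReal.ofReal_ne_top hcost))
    exact mul_le_mul_right (Finset.sum_le_sum fun j _ =>
      setLIntegral_typicalDecode_ne_le _ _ hS c j) _

theorem achievable_of_le (h : RegularDensity p b ζ) {μ : Measure ℝ} [IsProbabilityMeasure μ]
    (hμ : IsTiltingInput p γ μ) (hγ : γ < 1 - ζ) [NeZero M] {t s D : ℝ} (hΔ : 0 < Δ) (hε : 0 < ε)
    (ht : 0 < t) (hs : 0 < s) (hD0 : 0 ≤ D)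
    (hD : n * (γ * deriv (surprisalCgf p) γ - surprisalCgf p γ) < D)
    (hts : Real.log t + s ≤
      n * ((1 - γ) * deriv (surprisalCgf p) γ - diffEntropy p + surprisalCgf p γ))
    (hle : D / Δ + (n * Var[infoDensity p γ; μ.prod (lawOf p)] / s ^ 2 + M / t) / ε ≤ 1) :
    Achievable p n Δ ε M := by
  have := h.isProbabilityMeasure_noiseLaw n
  have hch := hμ.isChannelDensity h hγ n
  set S : Set ((Fin n → ℝ) × (Fin n → ℝ)) :=
    {q | t * tiltedNoiseDensity p γ q.2 < shiftDensity p q.1 q.2}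
  have hS : MeasurableSet S :=
    measurableSet_lt ((hch.measurable_output.comp measurable_snd).const_mul t) hch.measurable
  obtain ⟨K, c, hK, hgood, hcost⟩ := hch.exists_codebook (𝓜 := Fin M) hS
    (hμ.ae_ae_pos_add h hγ.le n) ((hμ.integral_mul_log_tiltedNoiseDensity h hγ n).trans_lt hD)
    (ENNReal.ofReal Δ)⁻¹ (ENNReal.ofReal ε)⁻¹
  have hmiss : ∫⁻ q in Sᶜ, ENNReal.ofReal (shiftDensity p q.1 q.2) ∂(inputNoiseLaw p μ n)
      ≤ ENNReal.ofReal (n * Var[infoDensity p γ; μ.prod (lawOf p)] / s ^ 2) := by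
    rw [show Sᶜ = {q | shiftDensity p q.1 q.2 ≤ t * tiltedNoiseDensity p γ q.2} by
      ext; simp [S]]
    exact hμ.lintegral_threshold_le h hγ n ht hs (by rwa [hμ.integral_infoDensity h hγ])
  have hconfuse : Fintype.card (Fin M) * ∫⁻ q in S, ENNReal.ofReal (tiltedNoiseDensity p γ q.2)
      ∂(inputNoiseLaw p μ n) ≤ ENNReal.ofReal (M / t) := by
    rw [Fintype.card_fin, div_eq_mul_one_div, ENNReal.ofReal_mul (Nat.cast_nonneg M),
      ENNReal.ofReal_natCast]
    exact mul_le_mul_right (hch.setLIntegral_output_le ht) _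
  have := NeZero.of_pos hK
  have hVar := variance_nonneg (infoDensity p γ) (μ.prod (lawOf p))
  refine h.achievable_of_codebookCost_le hΔ hε hS hgood (hcost.trans (le_trans ?_
    (inv_ofReal_mul_add_le_one hΔ hε hD0 (by positivity) (by positivity) hle)))
  exact add_le_add_right (mul_le_mul_right (add_le_add hmiss hconfuse) _) _

end RegularDensity

end Achievability

section Limits

theorem tendsto_sqrt_natCast_atTop : Tendsto (fun n : ℕ => √(n : ℝ)) atTop atTop :=
  Real.tendsto_sqrt_atTop.comp tendsto_natCast_atTop_atTop

theorem sqrt_natCast_pos {n : ℕ} (hn : 0 < n) : 0 < √(n : ℝ) :=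
  Real.sqrt_pos.2 (Nat.cast_pos.2 hn)

theorem sqrt_natCast_mul_pos {n : ℕ} (hn : 0 < n) {Δ : ℝ} (hΔ : 0 < Δ) : 0 < √(n * Δ) :=
  Real.sqrt_pos.2 (mul_pos (Nat.cast_pos.2 hn) hΔ)

theorem tendsto_div_sqrt_nhdsGT {c : ℝ} (hc : 0 < c) :
    Tendsto (fun n : ℕ => c / √(n : ℝ)) atTop (𝓝[>] 0) := by
  refine tendsto_nhdsWithin_iff.2 ⟨tendsto_sqrt_natCast_atTop.const_div_atTop c, ?_⟩
  filter_upwards [eventually_gt_atTop 0] with n hn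
  exact div_pos hc (sqrt_natCast_pos hn)

theorem eventually_div_sqrt_lt (c : ℝ) {ξ : ℝ} (hξ : 0 < ξ) :
    ∀ᶠ n : ℕ in atTop, c / √(n : ℝ) < ξ :=
  (tendsto_sqrt_natCast_atTop.const_div_atTop c).eventually_lt_const hξ

theorem natCast_mul_eq_mul_div_mul_sqrt {n : ℕ} (hn : 0 < n) {c : ℝ} (hc : c ≠ 0) (x : ℝ) :
    n * x = c * (x / (c / √(n : ℝ))) * √(n : ℝ) := by
  have hsqrt := (sqrt_natCast_pos hn).ne'
  nth_rewrite 1 [← Real.sq_sqrt (Nat.cast_nonneg n)]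
  field_simp

theorem natCast_mul_eq_sq_mul_div_sq {n : ℕ} (hn : 0 < n) {c : ℝ} (hc : c ≠ 0) (x : ℝ) :
    n * x = c ^ 2 * (x / (c / √(n : ℝ)) ^ 2) := by
  have hsqrt := (sqrt_natCast_pos hn).ne'
  nth_rewrite 1 [← Real.sq_sqrt (Nat.cast_nonneg n)]
  field_simp

theorem eventually_floor_exp_div_exp_le {R R' κ : ℝ} (hR : R < R') (hκ : 0 < κ) :
    ∀ᶠ n : ℕ in atTop,
      (⌊Real.exp (R * √(n : ℝ))⌋₊ : ℝ) / Real.exp (R' * √(n : ℝ)) ≤ κ := by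
  have hexp := Real.tendsto_exp_neg_atTop_nhds_zero.comp
    (tendsto_sqrt_natCast_atTop.const_mul_atTop (sub_pos.2 hR))
  filter_upwards [hexp.eventually_lt_const hκ] with n hn
  calc
    _ ≤ Real.exp (R * √(n : ℝ)) / Real.exp (R' * √(n : ℝ)) := by
      gcongr
      exact Nat.floor_le (Real.exp_pos _).le
    _ = Real.exp (-((R' - R) * √(n : ℝ))) := by rw [← Real.exp_sub]; ring_nf
    _ ≤ κ := hn.le

theorem log_sub_log_two_le_log_floor {x : ℝ} (hx : 1 ≤ x) :
    Real.log x - Real.log 2 ≤ Real.log ⌊x⌋₊ := by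
  have hfloor : (1 : ℝ) ≤ ⌊x⌋₊ := by exact_mod_cast Nat.floor_pos.2 hx
  rw [← Real.log_div (by positivity) (by norm_num)]
  exact Real.log_le_log (by positivity) (by linarith [Nat.lt_floor_add_one x])

variable {p : ℝ → ℝ} {b ζ ξ : ℝ} {Δ ε x : ℝ} {n M : ℕ}

theorem Achievable.log_le_maxLogSize (hA : Achievable p n Δ ε M) :
    ((Real.log M : ℝ) : EReal) ≤ maxLogSize p n Δ ε :=
  le_iSup₂ (f := fun (M : ℕ) (_ : Achievable p n Δ ε M) => ((Real.log M : ℝ) : EReal)) M hA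

theorem achievable_one (p : ℝ → ℝ) (n : ℕ) [SigmaFinite (noiseLaw p n)] (Δ : ℝ) (hε : 0 ≤ ε) :
    Achievable p n Δ ε 1 := by
  refine ⟨one_pos, 1, one_pos, ⟨fun _ _ => 0, fun _ _ => 0, fun _ _ => by simp⟩, ?_, ?_⟩
  · simp [Code.outputLaw, InformationTheory.klDiv_self]
  · simpa [Code.errorProb] using hε

theorem maxLogSize_nonneg (p : ℝ → ℝ) (n : ℕ) [SigmaFinite (noiseLaw p n)] (Δ : ℝ) (hε : 0 ≤ ε) :
    0 ≤ maxLogSize p n Δ ε := by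
  simpa using (achievable_one p n Δ hε).log_le_maxLogSize

theorem le_liminf_of_eventually_achievable {R : ℝ} (hΔ : 0 < Δ) (hR : 0 ≤ R) (hx : x * √Δ < R)
    (hA : ∀ᶠ n : ℕ in atTop, Achievable p n Δ ε ⌊Real.exp (R * √(n : ℝ))⌋₊) :
    (x : EReal) ≤ liminf (fun n : ℕ => maxLogSize p n Δ ε / ((√(n * Δ) : ℝ) : EReal)) atTop := by
  have hloss := (tendsto_sqrt_natCast_atTop.const_div_atTop (Real.log 2)).const_sub R
  rw [sub_zero] at hloss
  refine le_liminf_of_le (by isBoundedDefault) ?_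
  filter_upwards [hA, hloss.eventually_const_lt hx, eventually_gt_atTop 0] with n hAn hlt hn
  have hsqrt := sqrt_natCast_pos hn
  have hfloor := log_sub_log_two_le_log_floor (Real.one_le_exp (mul_nonneg hR hsqrt.le))
  rw [Real.log_exp] at hfloor
  rw [EReal.le_div_iff_mul_le (by exact_mod_cast sqrt_natCast_mul_pos hn hΔ) (EReal.coe_ne_top _)]
  refine le_trans ?_ hAn.log_le_maxLogSize
  rw [← EReal.coe_mul, EReal.coe_le_coe_iff]
  calc
    x * √(n * Δ) = x * √Δ * √n := by rw [Real.sqrt_mul (Nat.cast_nonneg n)]; ring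
    _ ≤ (R - Real.log 2 / √n) * √n := mul_le_mul_of_nonneg_right hlt.le hsqrt.le
    _ = R * √n - Real.log 2 := by rw [sub_mul, div_mul_cancel₀ _ hsqrt.ne']
    _ ≤ _ := hfloor

namespace RegularDensity

theorem eventually_achievable (h : RegularDensity p b ζ) (hξ : 0 < ξ)
    (hdec : ∀ γ ∈ Set.Ico 0 ξ, IsAdditiveOutput p (tilted p γ)) {c R : ℝ} (hΔ : 0 < Δ)
    (hε : 0 < ε) (hc : 0 < c) (hcV : c ^ 2 * (Var[surprisal p; lawOf p] / 2) < Δ)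
    (hR : 0 ≤ R) (hRc : R < c * Var[surprisal p; lawOf p]) :
    ∀ᶠ n : ℕ in atTop, Achievable p n Δ ε ⌊Real.exp (R * √(n : ℝ))⌋₊ := by
  obtain ⟨D, hVD, hDΔ⟩ := exists_between hcV
  obtain ⟨R₂, hRR₂, hR₂c⟩ := exists_between hRc
  obtain ⟨R₁, hRR₁, hR₁₂⟩ := exists_between hRR₂
  have hD : 0 ≤ D := le_trans
    (mul_nonneg (sq_nonneg c) (div_nonneg (variance_nonneg _ _) zero_le_two)) hVD.le
  have hgap : 0 < R₂ - R₁ := sub_pos.2 hR₁₂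
  set κ := (1 - D / Δ) * ε / 2 with hκ_def
  have hκ : 0 < κ := half_pos (mul_pos (sub_pos.2 ((div_lt_one hΔ).2 hDΔ)) hε)
  have hbudget : D / Δ + (κ + κ) / ε = 1 := by
    rw [hκ_def]
    field_simp
    ring
  have hγ := tendsto_div_sqrt_nhdsGT hc
  filter_upwards [eventually_div_sqrt_lt c hξ, eventually_div_sqrt_lt c h.one_sub_exponent_pos,
    hγ.eventually (h.eventually_variance_infoDensity_le (mul_pos hκ (pow_pos hgap 2))),
    ((h.tendsto_mul_deriv_sub_surprisalCgf_div_sq.comp hγ).const_mul (c ^ 2)).eventually_lt_const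
      hVD,
    ((h.tendsto_information_div.comp hγ).const_mul c).eventually_const_lt hR₂c,
    eventually_floor_exp_div_exp_le hRR₁ hκ, eventually_gt_atTop 0]
    with n hγξ hγζ hvar hdiv hinfo hconfuse hn
  have hsqrt := sqrt_natCast_pos hn
  obtain ⟨μ, hprob, hμ⟩ := h.exists_isTiltingInput hγζ.le (hdec _ ⟨(div_pos hc hsqrt).le, hγξ⟩)
  have := NeZero.of_pos (Nat.floor_pos.2 (Real.one_le_exp (mul_nonneg hR hsqrt.le)))
  refine h.achievable_of_le hμ hγζ hΔ hε (Real.exp_pos (R₁ * √n)) (mul_pos hgap hsqrt) hD ?_ ?_ ?_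
  · rw [natCast_mul_eq_sq_mul_div_sq hn hc.ne']
    exact hdiv
  · rw [Real.log_exp, natCast_mul_eq_mul_div_mul_sqrt hn hc.ne', ← add_mul, add_sub_cancel]
    exact mul_le_mul_of_nonneg_right hinfo.le hsqrt.le
  · have hmiss : n * Var[infoDensity p (c / √n); μ.prod (lawOf p)] / ((R₂ - R₁) * √n) ^ 2 ≤ κ := by
      rw [mul_pow, Real.sq_sqrt (Nat.cast_nonneg n), div_le_iff₀ (by positivity),
        ← mul_assoc, mul_comm (n : ℝ)]
      exact mul_le_mul_of_nonneg_right (hvar μ hprob hμ) (Nat.cast_nonneg n)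
    rw [← hbudget]
    gcongr

theorem le_liminf (h : RegularDensity p b ζ) (hξ : 0 < ξ)
    (hdec : ∀ γ ∈ Set.Ico 0 ξ, IsAdditiveOutput p (tilted p γ)) (hΔ : 0 < Δ)
    (hε : 0 < ε) (hx : x < √2 * √(Var[surprisal p; lawOf p])) :
    (x : EReal) ≤ liminf (fun n : ℕ => maxLogSize p n Δ ε / ((√(n * Δ) : ℝ) : EReal)) atTop := by
  rcases lt_or_ge x 0 with hneg | hx0
  · refine le_liminf_of_le (by isBoundedDefault) (Eventually.of_forall fun n => ?_)
    have := h.isProbabilityMeasure_noiseLaw n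
    exact (EReal.coe_nonpos.2 hneg.le).trans (EReal.div_nonneg (maxLogSize_nonneg p n Δ hε.le)
      (EReal.coe_nonneg.2 (Real.sqrt_nonneg _)))
  rw [← Real.sqrt_mul zero_le_two] at hx
  have hV : 0 < Var[surprisal p; lawOf p] := by
    linarith [Real.sqrt_pos.1 (hx0.trans_lt hx)]
  obtain ⟨y', hxy', hy'V⟩ := exists_between hx
  obtain ⟨y, hxy, hyy'⟩ := exists_between hxy'
  set V := Var[surprisal p; lawOf p]
  have hsqrtΔ : 0 < √Δ := Real.sqrt_pos.2 hΔ
  have hy' : 0 < y' := hx0.trans_lt hxy'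
  have hdiv : (y' * √Δ / V) ^ 2 * (V / 2) < Δ := by
    have hsq : y' ^ 2 < 2 * V := (Real.lt_sqrt hy'.le).1 hy'V
    calc
      _ = y' ^ 2 / (2 * V) * Δ := by
        rw [div_pow, mul_pow, Real.sq_sqrt hΔ.le]
        field_simp
      _ < 1 * Δ := by gcongr; exact (div_lt_one (by positivity)).2 hsq
      _ = Δ := one_mul Δ
  have hrate : y * √Δ < y' * √Δ / V * V := by
    rw [div_mul_cancel₀ _ hV.ne']
    gcongr
  have hrate0 : 0 ≤ y * √Δ := mul_nonneg (hx0.trans hxy.le) hsqrtΔ.le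
  exact le_liminf_of_eventually_achievable hΔ hrate0 (by gcongr)
    (h.eventually_achievable hξ hdec hΔ hε (by positivity) hdiv hrate0 hrate)

theorem maxLogSize_div_sqrt_le (h : RegularDensity p b ζ) (hΔ : 0 < Δ) (hε : ε < 1) (hn : 0 < n)
    {c : ℝ} (hc : 0 < c) (hγ : c / √(n : ℝ) < 1 - ζ) :
    maxLogSize p n Δ ε / ((√(n * Δ) : ℝ) : EReal)
      ≤ (((c * ((surprisalCgf p (c / √n) - c / √n * diffEntropy p) / (c / √n) ^ 2) + Δ / c
        + 1 / √n) / ((1 - ε) * √Δ) : ℝ) : EReal) := by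
  have hsqrt := sqrt_natCast_pos hn
  have hε' : 0 < 1 - ε := sub_pos.2 hε
  have : 0 < √Δ := Real.sqrt_pos.2 hΔ
  rw [EReal.div_le_iff_le_mul (by exact_mod_cast sqrt_natCast_mul_pos hn hΔ) (EReal.coe_ne_top _)]
  refine iSup₂_le fun M hA => ?_
  rw [← EReal.coe_mul, EReal.coe_le_coe_iff]
  refine le_of_mul_le_mul_left
    ((hA.one_sub_mul_log_le h hΔ.le (div_pos hc hsqrt) hγ.le).trans_eq ?_) hε'
  rw [natCast_mul_eq_sq_mul_div_sq hn hc.ne', Real.sqrt_mul (Nat.cast_nonneg n)]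
  field_simp

theorem liminf_le (h : RegularDensity p b ζ) {c : ℝ} (hΔ : 0 < Δ) (hε : ε < 1) (hc : 0 < c) :
    liminf (fun n : ℕ => maxLogSize p n Δ ε / ((√(n * Δ) : ℝ) : EReal)) atTop
      ≤ (((c * (Var[surprisal p; lawOf p] / 2) + Δ / c) / ((1 - ε) * √Δ) : ℝ) : EReal) := by
  have hlim := ((((h.tendsto_surprisalCgf_sub_div_sq.comp (tendsto_div_sqrt_nhdsGT hc)).const_mul
    c).add_const (Δ / c)).add (tendsto_sqrt_natCast_atTop.const_div_atTop 1)).div_const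
      ((1 - ε) * √Δ)
  rw [add_zero] at hlim
  rw [← ((continuous_coe_real_ereal.tendsto _).comp hlim).liminf_eq]
  refine liminf_le_liminf ?_ (by isBoundedDefault) (by isBoundedDefault)
  filter_upwards [eventually_div_sqrt_lt c h.one_sub_exponent_pos, eventually_gt_atTop 0]
    with n hγ hn
  exact h.maxLogSize_div_sqrt_le hΔ hε hn hc hγ

theorem eventually_liminf_lt (h : RegularDensity p b ζ) (hΔ : 0 < Δ)
    (hx : √2 * √(Var[surprisal p; lawOf p]) < x) :
    ∀ᶠ ε in 𝓝[>] (0 : ℝ),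
      liminf (fun n : ℕ => maxLogSize p n Δ ε / ((√(n * Δ) : ℝ) : EReal)) atTop < x := by
  have hx0 : 0 < x := lt_of_le_of_lt (by positivity) hx
  rw [← Real.sqrt_mul zero_le_two, Real.sqrt_lt' hx0] at hx
  set V := Var[surprisal p; lawOf p]
  have hsqrtΔ : 0 < √Δ := Real.sqrt_pos.2 hΔ
  have hval : (2 * √Δ / x * (V / 2) + Δ / (2 * √Δ / x)) / ((1 - 0) * √Δ) < x := by
    calc
      _ = V / x + x / 2 := by
        nth_rw 2 [← Real.mul_self_sqrt hΔ.le]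
        field_simp
        ring
      _ < x / 2 + x / 2 := by
        refine (add_lt_add_iff_right _).2 ((div_lt_iff₀ hx0).2 ?_)
        linarith
      _ = x := add_halves x
  have hcont : ContinuousAt
      (fun ε : ℝ => (2 * √Δ / x * (V / 2) + Δ / (2 * √Δ / x)) / ((1 - ε) * √Δ)) 0 :=
    ContinuousAt.div (by fun_prop) (by fun_prop) (by simpa using hsqrtΔ.ne')
  filter_upwards [mem_nhdsWithin_of_mem_nhds (hcont.eventually_lt continuousAt_const hval),
    mem_nhdsWithin_of_mem_nhds (Iio_mem_nhds one_pos)] with ε hlt hε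
  exact (h.liminf_le hΔ hε (by positivity)).trans_lt (EReal.coe_lt_coe_iff.2 hlt)

theorem isScalingConstant (h : RegularDensity p b ζ) (hξ : 0 < ξ)
    (hdec : ∀ γ ∈ Set.Ico 0 ξ, IsAdditiveOutput p (tilted p γ)) (hΔ : 0 < Δ) :
    IsScalingConstant p Δ (√2 * √(Var[surprisal p; lawOf p])) := by
  refine tendsto_order.2 ⟨fun a ha => ?_, fun a ha => ?_⟩
  · obtain ⟨x, hax, hx⟩ := EReal.lt_iff_exists_real_btwn.1 ha
    filter_upwards [self_mem_nhdsWithin] with ε hε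
    exact hax.trans_le (h.le_liminf hξ hdec hΔ hε (EReal.coe_lt_coe_iff.1 hx))
  · obtain ⟨x, hx, hxa⟩ := EReal.lt_iff_exists_real_btwn.1 ha
    filter_upwards [h.eventually_liminf_lt hΔ (EReal.coe_lt_coe_iff.1 hx)] with ε hε
    exact hε.trans hxa

end RegularDensity

end Limits

section Congruence

variable {p q : ℝ → ℝ}

theorem lawOf_congr (hpq : p =ᵐ[volume] q) : lawOf p = lawOf q :=
  withDensity_congr_ae (hpq.mono fun z hz => by simp only [hz])

theorem tilted_congr (hpq : p =ᵐ[volume] q) (γ : ℝ) : tilted p γ =ᵐ[volume] tilted q γ := by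
  have hrpow : (fun t => p t ^ (1 - γ)) =ᵐ[volume] fun t => q t ^ (1 - γ) :=
    hpq.mono fun z hz => by simp only [hz]
  filter_upwards [hpq] with z hz
  rw [tilted, tilted, integral_congr_ae hrpow, hz]

theorem IsAdditiveOutput.congr {p' q' : ℝ → ℝ} (h : IsAdditiveOutput p p')
    (hpq : lawOf p = lawOf q) (hpq' : lawOf p' = lawOf q') : IsAdditiveOutput q q' := by
  simpa only [IsAdditiveOutput, hpq, hpq'] using h

theorem IsScalingConstant.congr {Δ L : ℝ} (h : IsScalingConstant p Δ L)
    (hpq : lawOf p = lawOf q) : IsScalingConstant q Δ L := by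
  have hnoise (n : ℕ) : noiseLaw p n = noiseLaw q n := by rw [noiseLaw, noiseLaw, hpq]
  simpa only [IsScalingConstant, maxLogSize, Achievable, Code.outputLaw, Code.errorProb, hnoise]
    using h

theorem variance_surprisal_congr (hpq : p =ᵐ[volume] q) :
    Var[surprisal q; lawOf q] = Var[fun z => Real.log (p z); lawOf p] := by
  have hneg : surprisal q =ᵐ[lawOf q] fun z => -Real.log (p z) := by
    filter_upwards [(withDensity_absolutelyContinuous _ _).ae_le hpq] with z hz
    rw [surprisal, hz]
  rw [lawOf_congr hpq, variance_congr hneg, variance_fun_neg]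

theorem IsPDF.exists_regularDensity (hp : IsPDF p) {b ζ : ℝ} (hb : ∀ z, p z ≤ b)
    (hζ : ζ ∈ Set.Ioo (0 : ℝ) 1) (hint : Integrable (fun z => p z ^ ζ) volume) :
    ∃ q, p =ᵐ[volume] q ∧ RegularDensity q (max b 1) ζ := by
  obtain ⟨g, hg, hpg⟩ := hp.integrable.aestronglyMeasurable.aemeasurable
  have hae : p =ᵐ[volume] fun z => min (max (g z) 0) (max b 1) := by
    filter_upwards [hpg] with z hz
    rw [← hz, max_eq_left (hp.nonneg z), min_eq_left ((hb z).trans (le_max_left _ _))]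
  exact ⟨_, hae,
    { measurable := (hg.max measurable_const).min measurable_const
      nonneg := fun _ => le_min (le_max_right _ _) (zero_le_one.trans (le_max_right _ _))
      one_le := le_max_right _ _
      le_bound := fun _ => min_le_right _ _
      integrable := hp.integrable.congr hae
      integral_eq_one := (integral_congr_ae hae).symm.trans hp.integral_eq_one
      exponent_mem := hζ
      integrable_rpow := hint.congr (hae.mono fun _ hz => by simp only [hz]) }⟩

end Congruence

end Covert

theorem theorem2_general {p : ℝ → ℝ} (hp : Covert.IsPDF p) {b ζ ξ Δ : ℝ} (hb : ∀ z, p z ≤ b)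
    (hζ : ζ ∈ Set.Ioo (0 : ℝ) 1) (hint : Integrable (fun z => p z ^ ζ) volume) (hξ : 0 < ξ)
    (hdec : ∀ γ ∈ Set.Ico 0 ξ, Covert.IsAdditiveOutput p (Covert.tilted p γ)) (hΔ : 0 < Δ) :
    Covert.IsScalingConstant p Δ
      (√2 * √(variance (fun z => Real.log (p z)) (Covert.lawOf p))) := by
  obtain ⟨q, hpq, hq⟩ := hp.exists_regularDensity hb hζ hint
  have hlaw := Covert.lawOf_congr hpq
  rw [← Covert.variance_surprisal_congr hpq]
  exact (hq.isScalingConstant hξ (fun γ hγ => (hdec γ hγ).congr hlaw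
    (Covert.lawOf_congr (Covert.tilted_congr hpq γ))) hΔ).congr hlaw.symm

theorem theorem2 (p : ℝ → ℝ) (hp : Covert.IsPDF p)
    (hint : Covert.IntegrabilityConditions p) (hass : Covert.TightnessAssumption p)
    (Δ : ℝ) (hΔ : 0 < Δ) :
    Covert.IsScalingConstant p Δ
      (√2 * √(variance (fun z => Real.log (p z)) (Covert.lawOf p))) := by
  rcases hint, hass with ⟨⟨ζ, hζ, -, hrpow, -⟩, ⟨⟨b, -, hb⟩, -, ξ, hξ, hdec⟩⟩
  exact theorem2_general hp hb hζ hrpow hξ.1 hdec hΔ
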